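/- Rings are associative with identity and $R\subseteq S$ is a ring extension (same identity). For $s\in S$ put $(R:s)=\{a\in R\mid as\in R\}$ and $(s:R)=\{a\in R\mid sa\in R\}$; for a left ideal $I$, a right ideal $J$ of $R$ and $r\in R$ put $(I:r)=\{a\in R\mid ar\in I\}$ and $(r:J)=\{a\in R\mid ra\in J\}$. For an intermediate ring $R\subseteq T\subseteq S$ let $$T'=\{s\in T\mid T(R:rs)=T\text{ and }(sr:R)T=T\text{ for every }r\in R\}.$$ Regard $R$-bimodules as one-sided modules over $E=R\otimes_{\mathbb Z}R^{op}$. If $\mathcal F_l$, $\mathcal F_r$ are Gabriel filters of left, respectively right, ideals of $R$, the induced filter consists of all one-sided ideals of $E$ that contain $I\otimes R^{op}+R\otimes J$ for some $I\in\mathcal F_l$, $J\in\mathcal F_r$. For a Gabriel filter $\mathcal F$ on $E$ with torsion submodule $t(R)$ of the bimodule $R$, the symmetric quotient of $R$ is the $R$-bimodule $R_{\mathcal F}=\varinjlim_{K\in\mathcal F}\mathrm{Hom}_E(K,R/t(R))$ with its canonical map from $R$. A homomorphism on $K\supseteq I\otimes R^{op}+R\otimes J$ restricts to a compatible pair $f:I\to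 R/t(R)$, $g:J\to R/t(R)$, $f(i)j=ig(j)$, and the product of the classes of $(f_1,g_1)$ and $(f_2,g_2)$ is the class of $(f_2\circ f_1,g_1\circ g_2)$ (on a suitable smaller $I\in\mathcal F_l$, $J\in\mathcal F_r$). A ring $Q$ with a ring homomorphism $q:R\to Q$ is the symmetric ring of quotients if there is a bijection $R_{\mathcal F}\to Q$ that preserves the bimodule structure and products and carries the canonical map to $q$. A ring homomorphism $R\to T$ makes $T$ a perfect symmetric ring of quotients of $R$ if it is a ring epimorphism and makes $T$ flat both as a left and as a right $R$-module. Then: 1. $S'$ is a subring of $S$ that contains $R$. 2. $\mathcal F_l=\{I\mid S(I:r)=S\text{ for all }r\in R\}$ and $\mathcal F_r=\{J\mid (r:J)S=S\text{ for all }r\in R\}$ are Gabriel filters, and $S'$ (with the inclusion of $R$) is the symmetric ring of quotients of $R$ with respect to the torsion theory induced by them. 3. $S$ is a perfect symmetric ring of quotients of $R$ (via the inclusion) if and only if $S'=S$. 4. Define $S^{(0)}=S$, $S^{(\alpha+1)}=(S^{(\alpha)})'$, and $S^{(\alpha)}=\bigcap_{\beta<\alpha}S^{(\beta)}$ for limit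 ordinals $\alpha$. Every $S^{(\alpha)}$ is a subring of $S$ that contains $R$, and there is an ordinal $\gamma$ such that $S^{(\gamma)}=S^{(\gamma+1)}$ and $S^{(\alpha)}=S^{(\gamma)}$ for all $\alpha\ge\gamma$. 5. If $R\subseteq T\subseteq S$ is an intermediate ring and the inclusion $R\subseteq T$ is a ring epimorphism that makes $T$ left and right $R$-flat, then $T\subseteq S'$. 6. If $S$ is left and right $R$-flat, then ${}_S\mathcal F=\{I\mid S\otimes_R R/I=0\}$ and $\mathcal F_S=\{J\mid R/J\otimes_R S=0\}$ are Gabriel filters of left, respectively right, ideals, the bimodules $M$ with $S\otimes_R M\otimes_R S=0$ form a hereditary torsion class, with Gabriel filter ${}_S\mathcal F_S$ on $E$, and $S'$ (with the inclusion of $R$) is the symmetric ring of quotients of $R$ with respect to ${}_S\mathcal F_S$ (products being computed on ideals in ${}_S\mathcal F$ and $\mathcal F_S$). It is also the symmetric ring of quotients of $R$ with respect to the torsion theory induced by ${}_S\mathcal F$ and $\mathcal F_S$. -/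

import Mathlib

open scoped TensorProduct

universe u

namespace SymQuot

noncomputable section

/-! ### Gabriel filters and modules of quotients

All filters are filters of left ideals of some ring.  A right ideal of `R` is encoded as a left
ideal of `Rᵐᵒᵖ`, a right `R`-module as an `Rᵐᵒᵖ`-module, and an `R`-bimodule as a left module over
`R ⊗[ℤ] Rᵐᵒᵖ`, where `(a ⊗ op b) • m = a m b`. -/

/-- `(I : r) = {a | a * r ∈ I}` for a left ideal `I` of `A`.  For a right ideal `J` of `R`, seen as
a left ideal of `Rᵐᵒᵖ`, `colon J (op r)` is the right ideal `(r : J) = {a | r * a ∈ J}`. -/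
def colon {A : Type*} [Ring A] (I : Ideal A) (r : A) : Ideal A :=
  Submodule.comap (LinearMap.toSpanSingleton A A r) I

/-- `F` is a Gabriel filter of left ideals of `A`. -/
structure IsGabriel {A : Type*} [Ring A] (F : Set (Ideal A)) : Prop where
  top_mem : ⊤ ∈ F
  mem_of_le : ∀ I J : Ideal A, I ∈ F → I ≤ J → J ∈ F
  inf_mem : ∀ I J : Ideal A, I ∈ F → J ∈ F → I ⊓ J ∈ F
  colon_mem : ∀ I ∈ F, ∀ r : A, colon I r ∈ F
  mem_of_colon : ∀ J ∈ F, ∀ I : Ideal A, (∀ a ∈ J, colon I a ∈ F) → I ∈ F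

section Quotients

variable {A : Type*} [Ring A] (F : Set (Ideal A)) (M : Type*) [AddCommGroup M] [Module A M]

/-- The torsion submodule of `M`: it consists of the elements whose annihilator is in `F`
(for a Gabriel filter `F` these elements already form a submodule). -/
def torsion : Submodule A M :=
  Submodule.span A {m | LinearMap.ker (LinearMap.toSpanSingleton A M m) ∈ F}

/-- The ideals in `F`, ordered by reverse inclusion. -/
abbrev FilterIndex : Type _ := {K : Ideal A // K ∈ F}ᵒᵈ

/-- The ideal belonging to an index. -/
def FilterIndex.ideal {F : Set (Ideal A)} (K : FilterIndex F) : Ideal A := (OrderDual.ofDual K).1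

/-- Restriction of homomorphisms `K → M / t(M)` to a smaller ideal of the filter. -/
def restrictHom (K K' : FilterIndex F) (h : K ≤ K') :
    (K.ideal →ₗ[A] M ⧸ torsion F M) →+ (K'.ideal →ₗ[A] M ⧸ torsion F M) where
  toFun φ := φ.comp (Submodule.inclusion h)
  map_zero' := rfl
  map_add' _ _ := rfl

open Classical in
/-- The module of quotients `M_F`, the direct limit of `Hom_A(K, M / t(M))` over `K ∈ F`. -/
def Quotients : Type _ :=
  AddCommGroup.DirectLimit (fun K : FilterIndex F => (K.ideal →ₗ[A] M ⧸ torsion F M))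
    (restrictHom F M)

open Classical in
instance : AddCommGroup (Quotients F M) :=
  AddCommGroup.DirectLimit.addCommGroup
    (fun K : FilterIndex F => (K.ideal →ₗ[A] M ⧸ torsion F M)) (restrictHom F M)

variable {F M}

open Classical in
/-- The class in `M_F` of a homomorphism `φ : K → M / t(M)`, where `K ∈ F`. -/
def Quotients.mk {K : Ideal A} (hK : K ∈ F) (φ : K →ₗ[A] M ⧸ torsion F M) : Quotients F M :=
  AddCommGroup.DirectLimit.of
    (fun K : FilterIndex F => (K.ideal →ₗ[A] M ⧸ torsion F M)) (restrictHom F M)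
    (OrderDual.toDual ⟨K, hK⟩) φ

variable (F M)

/-- The homomorphism `K → M / t(M)`, `κ ↦ κ • m + t(M)`; its class is the image of `m` under the
canonical map `M → M_F`. -/
def canonicalHom (K : Ideal A) (m : M) : K →ₗ[A] M ⧸ torsion F M :=
  ((torsion F M).mkQ.comp (LinearMap.toSpanSingleton A M m)).comp K.subtype

end Quotients

/-! ### Symmetric rings of quotients -/

section Symmetric

variable {R Q : Type*} [Ring R] [Ring Q]

/-- The ring over which left modules are `R`-bimodules. -/
abbrev Env (R : Type*) [Ring R] : Type _ := R ⊗[ℤ] Rᵐᵒᵖ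

/-- `R` as an `R`-bimodule. -/
instance ringBimodule : Module (Env R) R := TensorProduct.Algebra.module

/-- A ring homomorphism `f : R → Q` makes `Q` an `R`-bimodule: `a ⊗ op b` acts on `Q` as
`x ↦ f a * x * f b`. -/
def bimoduleAction (f : R →+* Q) : Env R →+* Module.End ℤ Q :=
  (AlgHom.mulLeftRight ℤ Q).toRingHom.comp
    (Algebra.TensorProduct.map f.toIntAlgHom (RingHom.op f).toIntAlgHom).toRingHom

/-- `a ⊗ 1`, the action of `a` from the left. -/
def inl (a : R) : Env R := a ⊗ₜ[ℤ] (1 : Rᵐᵒᵖ)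

/-- `1 ⊗ b`, the action of `b` from the right. -/
def inr (b : Rᵐᵒᵖ) : Env R := (1 : R) ⊗ₜ[ℤ] b

/-- The filter induced by a filter `Fl` of left ideals and a filter `Fr` of right ideals of `R`:
all `K` that contain `I ⊗ Rᵒᵖ + R ⊗ J` for some `I ∈ Fl` and `J ∈ Fr`. -/
def inducedFilter (Fl : Set (Ideal R)) (Fr : Set (Ideal Rᵐᵒᵖ)) : Set (Ideal (Env R)) :=
  {K | ∃ I ∈ Fl, ∃ J ∈ Fr, Ideal.span (inl '' (I : Set R)) ⊔ Ideal.span (inr '' (J : Set Rᵐᵒᵖ)) ≤ K}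

/-- The multiplication of the symmetric ring of quotients in terms of compatible pairs.
A homomorphism `φ` on `K` yields the compatible pair `f i = φ (i ⊗ 1)`, `g j = φ (1 ⊗ j)`.
The product of the classes of `(f₁, g₁)` and `(f₂, g₂)` is the class of `(f₂ ∘ f₁, g₁ ∘ g₂)`.
`IsProduct` says that `χ` represents the product of the classes of `φ₁` and `φ₂`. -/
def IsProduct {F : Set (Ideal (Env R))} (Fl : Set (Ideal R)) (Fr : Set (Ideal Rᵐᵒᵖ))
    {K₁ K₂ K : Ideal (Env R)} (φ₁ : K₁ →ₗ[Env R] R ⧸ torsion F R)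
    (φ₂ : K₂ →ₗ[Env R] R ⧸ torsion F R) (χ : K →ₗ[Env R] R ⧸ torsion F R) : Prop :=
  (∃ I ∈ Fl, ∀ i ∈ I, ∃ (i' : R) (h₁ : inl i ∈ K₁) (h₂ : inl i' ∈ K₂) (h : inl i ∈ K),
    φ₁ ⟨inl i, h₁⟩ = (torsion F R).mkQ i' ∧ χ ⟨inl i, h⟩ = φ₂ ⟨inl i', h₂⟩) ∧
  (∃ J ∈ Fr, ∀ j ∈ J, ∃ (j' : R) (h₂ : inr j ∈ K₂) (h₁ : inr (MulOpposite.op j') ∈ K₁)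
    (h : inr j ∈ K),
    φ₂ ⟨inr j, h₂⟩ = (torsion F R).mkQ j' ∧
      χ ⟨inr j, h⟩ = φ₁ ⟨inr (MulOpposite.op j'), h₁⟩)

/-- The ring `Q`, with the ring homomorphism `q : R → Q`, is the symmetric ring of quotients of `R`
with respect to a bimodule torsion theory.  `F` is the filter of the torsion theory; `Fl` and `Fr`
are Gabriel filters of left and right ideals of `R` through which the multiplication is computed
(`F = inducedFilter Fl Fr` for the torsion theory induced by `Fl` and `Fr`).
There is a bijection `e` from the module of quotients `R_F` to `Q` which is additive,
`R`-bilinear (the action on `R_F` being `ε • [φ] = [κ ↦ φ (κ * ε)]`), multiplicative, and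
turns the canonical map `R → R_F` into `q`. -/
def IsSymmetricRingOfQuotients (F : Set (Ideal (Env R))) (Fl : Set (Ideal R))
    (Fr : Set (Ideal Rᵐᵒᵖ)) (q : R →+* Q) : Prop :=
  IsGabriel Fl ∧ IsGabriel Fr ∧ IsGabriel F ∧
  ∃ e : Quotients F R ≃+ Q,
    (∀ (K : Ideal (Env R)) (hK : K ∈ F) (r : R),
      e (Quotients.mk hK (canonicalHom F R K r)) = q r) ∧
    (∀ (K K' : Ideal (Env R)) (hK : K ∈ F) (hK' : K' ∈ F) (φ : K →ₗ[Env R] R ⧸ torsion F R)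
      (ψ : K' →ₗ[Env R] R ⧸ torsion F R) (ε : Env R),
      (∀ κ : K', ∃ h : (κ : Env R) * ε ∈ K, ψ κ = φ ⟨κ * ε, h⟩) →
      e (Quotients.mk hK' ψ) = bimoduleAction q ε (e (Quotients.mk hK φ))) ∧
    (∀ (K₁ K₂ K : Ideal (Env R)) (hK₁ : K₁ ∈ F) (hK₂ : K₂ ∈ F) (hK : K ∈ F)
      (φ₁ : K₁ →ₗ[Env R] R ⧸ torsion F R) (φ₂ : K₂ →ₗ[Env R] R ⧸ torsion F R)
      (χ : K →ₗ[Env R] R ⧸ torsion F R),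
      IsProduct Fl Fr φ₁ φ₂ χ →
      e (Quotients.mk hK χ) = e (Quotients.mk hK₁ φ₁) * e (Quotients.mk hK₂ φ₂))

end Symmetric

/-! ### Tensor products and flatness over noncommutative rings -/

section Tensor

variable (R : Type*) [Ring R]

/-- The relations `n r ⊗ m = n ⊗ r m` in `N ⊗[ℤ] M`. -/
def balancedRel (N M : Type*) [AddCommGroup N] [Module Rᵐᵒᵖ N] [AddCommGroup M] [Module R M] :
    AddSubgroup (N ⊗[ℤ] M) :=
  AddSubgroup.closure {x | ∃ (n : N) (r : R) (m : M),
    x = (MulOpposite.op r • n) ⊗ₜ[ℤ] m - n ⊗ₜ[ℤ] (r • m)}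

/-- The tensor product over `R` of a right `R`-module `N` and a left `R`-module `M`. -/
abbrev BalTensor (N M : Type*) [AddCommGroup N] [Module Rᵐᵒᵖ N] [AddCommGroup M] [Module R M] :
    Type _ :=
  (N ⊗[ℤ] M) ⧸ balancedRel R N M

/-- The map `g ⊗ h` between tensor products over `R`. -/
def BalTensor.map {N N' M M' : Type*} [AddCommGroup N] [Module Rᵐᵒᵖ N] [AddCommGroup N']
    [Module Rᵐᵒᵖ N'] [AddCommGroup M] [Module R M] [AddCommGroup M'] [Module R M']
    (g : N →ₗ[Rᵐᵒᵖ] N') (h : M →ₗ[R] M') : BalTensor R N M →+ BalTensor R N' M' :=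
  QuotientAddGroup.map _ _
    (TensorProduct.map g.toAddMonoidHom.toIntLinearMap
      h.toAddMonoidHom.toIntLinearMap).toAddMonoidHom (by
      rw [balancedRel, AddSubgroup.closure_le]
      rintro _ ⟨n, r, m, rfl⟩
      refine AddSubgroup.subset_closure ⟨g n, r, h m, ?_⟩
      simp [map_sub])

end Tensor

section Hom

variable {R S : Type u} [Ring R] [Ring S]

/-- `S` as a left `R`-module through `f`. -/
abbrev leftMod (f : R →+* S) : Module R S := Module.compHom S f

/-- `S` as a right `R`-module through `f`. -/
abbrev rightMod (f : R →+* S) : Module Rᵐᵒᵖ S := Module.compHom S (RingHom.op f)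

/-- `f` makes `S` a flat left `R`-module: `- ⊗_R S` preserves injectivity. -/
def IsLeftFlat (f : R →+* S) : Prop :=
  letI := leftMod f
  ∀ (N N' : Type u) [AddCommGroup N] [AddCommGroup N'] [Module Rᵐᵒᵖ N] [Module Rᵐᵒᵖ N']
    (g : N →ₗ[Rᵐᵒᵖ] N'), Function.Injective g →
      Function.Injective (BalTensor.map R g (LinearMap.id : S →ₗ[R] S))

/-- `f` makes `S` a flat right `R`-module: `S ⊗_R -` preserves injectivity. -/
def IsRightFlat (f : R →+* S) : Prop :=
  letI := rightMod f
  ∀ (M M' : Type u) [AddCommGroup M] [AddCommGroup M'] [Module R M] [Module R M']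
    (h : M →ₗ[R] M'), Function.Injective h →
      Function.Injective (BalTensor.map R (LinearMap.id : S →ₗ[Rᵐᵒᵖ] S) h)

/-- `f` is an epimorphism in the category of rings. -/
def IsRingEpi (f : R →+* S) : Prop :=
  ∀ (T : Type u) [Ring T] (g h : S →+* T), g.comp f = h.comp f → g = h

/-- `f` makes `S` a perfect symmetric ring of quotients of `R`: it is a ring epimorphism and
makes `S` a flat left and a flat right `R`-module. -/
def IsPerfectSymmetric (f : R →+* S) : Prop :=
  IsRingEpi f ∧ IsLeftFlat f ∧ IsRightFlat f

/-- The left ideals `I` with `S ⊗_R (R / I) = 0`: the filter of the left tensoring torsion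
theory. -/
def leftTensorFilter (f : R →+* S) : Set (Ideal R) :=
  letI := rightMod f
  {I | Subsingleton (BalTensor R S (R ⧸ I))}

/-- The right ideals `J` with `(R / J) ⊗_R S = 0`: the filter of the right tensoring torsion
theory. -/
def rightTensorFilter (f : R →+* S) : Set (Ideal Rᵐᵒᵖ) :=
  letI := leftMod f
  {J | Subsingleton (BalTensor R (Rᵐᵒᵖ ⧸ J) S)}

/-- The relations `s r ⊗ m ⊗ t = s ⊗ r m ⊗ t` and `s ⊗ m r ⊗ t = s ⊗ m ⊗ r t` in
`S ⊗[ℤ] M ⊗[ℤ] S`, for an `R`-bimodule `M`. -/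
def twoSidedRel (f : R →+* S) (M : Type u) [AddCommGroup M] [Module (Env R) M] :
    AddSubgroup ((S ⊗[ℤ] M) ⊗[ℤ] S) :=
  AddSubgroup.closure
    ({x | ∃ (s : S) (r : R) (m : M) (t : S),
        x = ((s * f r) ⊗ₜ[ℤ] m) ⊗ₜ[ℤ] t - (s ⊗ₜ[ℤ] (inl r • m)) ⊗ₜ[ℤ] t} ∪
      {x | ∃ (s : S) (m : M) (r : R) (t : S),
        x = (s ⊗ₜ[ℤ] (inr (MulOpposite.op r) • m)) ⊗ₜ[ℤ] t - (s ⊗ₜ[ℤ] m) ⊗ₜ[ℤ] (f r * t)})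

/-- `S ⊗_R M ⊗_R S` for an `R`-bimodule `M`. -/
abbrev TwoSidedTensor (f : R →+* S) (M : Type u) [AddCommGroup M] [Module (Env R) M] : Type u :=
  ((S ⊗[ℤ] M) ⊗[ℤ] S) ⧸ twoSidedRel f M

/-- The filter of the symmetric tensoring torsion theory, in which an `R`-bimodule `M` is torsion
if and only if `S ⊗_R M ⊗_R S = 0`. -/
def symmetricTensorFilter (f : R →+* S) : Set (Ideal (Env R)) :=
  {K | Subsingleton (TwoSidedTensor f (Env R ⧸ K))}

end Hom

/-! ### The derived subring and its transfinite iteration -/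

section Morita

variable {S : Type u} [Ring S] (R : Subring S)

/-- The additive subgroup `XY` of finite sums of products `x y`. -/
def mulSpan (X Y : Set S) : AddSubgroup S :=
  AddSubgroup.closure {z | ∃ x ∈ X, ∃ y ∈ Y, z = x * y}

/-- `(R : s) = {a ∈ R | a s ∈ R}`. -/
def leftColon (s : S) : Set S := {a | a ∈ R ∧ a * s ∈ R}

/-- `(s : R) = {a ∈ R | s a ∈ R}`. -/
def rightColon (s : S) : Set S := {a | a ∈ R ∧ s * a ∈ R}

/-- `T' = {s ∈ T | T (R : rs) = T and (sr : R) T = T for all r ∈ R}`, for `T` an intermediate ring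
of the extension `R ⊆ S`. -/
def derived (T : Set S) : Set S :=
  {s | s ∈ T ∧ ∀ r ∈ R, (mulSpan T (leftColon R (r * s)) : Set S) = T ∧
    (mulSpan (rightColon R (s * r)) T : Set S) = T}

/-- `S^(0) = S`, `S^(α + 1) = (S^(α))'`, and `S^(α) = ⋂_{β < α} S^(β)` for `α` a limit. -/
def derivedSeq (α : Ordinal.{u}) : Set S :=
  Ordinal.limitRecOn α Set.univ (fun _ T => derived R T)
    (fun α _ T => {s | ∀ (β : Ordinal.{u}) (h : β < α), s ∈ T β h})

/-- The left ideals `I` of `R` with `S (I : r) = S` for all `r ∈ R`. -/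
def leftFilter : Set (Ideal R) :=
  {I | ∀ r : R, mulSpan Set.univ {x : S | ∃ a : R, a * r ∈ I ∧ x = a} = ⊤}

/-- The right ideals `J` of `R` with `(r : J) S = S` for all `r ∈ R`. -/
def rightFilter : Set (Ideal (R : Type u)ᵐᵒᵖ) :=
  {J | ∀ r : R, mulSpan {x : S | ∃ a : R, MulOpposite.op (r * a) ∈ J ∧ x = a} Set.univ = ⊤}

end Morita

end

end SymQuot

namespace SymQuot

/-! ### The bimodule action -/

section Bimodule

variable {R Q P : Type*} [Ring R] [Ring Q] [Ring P]

/-! Everything is reduced to one one-sided notion for a ring homomorphism `f : A → B`: an ideal `I`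
with `B f(I) = B`. Writing `1 = ∑ b_k f(a_k)` shows that such an ideal kills no nonzero element of a
`B`-module (`eq_zero_of_map_eq_top`). The right-hand versions are the same statements for
`RingHom.op f`, and `S'` is `symDenomSubring R.subtype` (`derived_univ`).

For the induced torsion theory, a homomorphism on `K` gives a compatible pair `(g, g')`. The element
`s = ∑ b_k f(g(a_k))` realizes it, with `1 = ∑ b_k f(a_k)` and the `a_k` in the left ideal of `K`
(`exists_mul_eq_of_compatible`). Cancellation gives uniqueness and the remaining identities.

For the tensoring torsion theory, `S ⊗ M ⊗ S` is the base change of `M` along `Env R → Env S`, which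
is again flat (`isRightFlat_envMap`). A homomorphism on `K` is therefore the action on some `s`
(`IsRightFlat.exists_smul_eq`), and `s ⊗ 1 = 1 ⊗ s` in `S ⊗_R S`. Flatness turns this equation into
the existence of denominators: modulo `R` it reads `1 ⊗ s̄ = 0`, so the annihilator of `s̄`
generates the unit ideal.

The same equation settles perfectness. For an epimorphism it holds for all `s`, so `S' = S`.
Conversely, if every element has denominators, two homomorphisms that agree on `R` agree on `S` by
cancellation, and the kernel of `M → S ⊗_R M` consists of torsion elements, which gives flatness. A
perfect intermediate ring `T` has all its denominators over `R`, and these remain denominators in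
`S`. The transfinite sequence is decreasing, so it stabilizes for reasons of cardinality. -/

theorem Env.induction_on {p : Env R → Prop} (ε : Env R)
    (tmul : ∀ a b, p (a ⊗ₜ b)) (add : ∀ a b, p a → p b → p (a + b)) : p ε :=
  TensorProduct.induction_on ε (by
    have h : p ((0 : R) ⊗ₜ (0 : Rᵐᵒᵖ)) := tmul 0 0
    rwa [TensorProduct.zero_tmul] at h) tmul add

theorem bimoduleAction_tmul (f : R →+* Q) (a : R) (b : Rᵐᵒᵖ) (x : Q) :
    bimoduleAction f (a ⊗ₜ b) x = f a * x * f b.unop := by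
  simp [bimoduleAction, mul_assoc]

@[simp]
theorem bimoduleAction_inl (f : R →+* Q) (a : R) (x : Q) :
    bimoduleAction f (inl a) x = f a * x := by
  simp [inl, bimoduleAction_tmul]

@[simp]
theorem bimoduleAction_inr (f : R →+* Q) (b : Rᵐᵒᵖ) (x : Q) :
    bimoduleAction f (inr b) x = x * f b.unop := by
  simp [inr, bimoduleAction_tmul]

theorem bimoduleAction_mul (f : R →+* Q) (κ ε : Env R) (x : Q) :
    bimoduleAction f (κ * ε) x = bimoduleAction f κ (bimoduleAction f ε x) := by
  rw [map_mul]; rfl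

theorem map_bimoduleAction (f : R →+* Q) (j : Q →+* P) (ε : Env R) (x : Q) :
    j (bimoduleAction f ε x) = bimoduleAction (j.comp f) ε (j x) := by
  induction ε using Env.induction_on with
  | tmul a b => simp [bimoduleAction_tmul]
  | add a b ha hb => simp [ha, hb]

theorem env_tmul_smul (a : R) (b : Rᵐᵒᵖ) (r : R) :
    (a ⊗ₜ[ℤ] b : Env R) • r = a * r * b.unop := by
  rw [TensorProduct.Algebra.smul_def, MulOpposite.smul_eq_mul_unop, smul_eq_mul, mul_assoc]

theorem env_smul_eq_bimoduleAction (ε : Env R) (r : R) :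
    ε • r = bimoduleAction (RingHom.id R) ε r := by
  induction ε using Env.induction_on with
  | tmul a b => simp [bimoduleAction_tmul, env_tmul_smul]
  | add a b ha hb => simp [add_smul, ha, hb]

theorem map_env_smul (f : R →+* Q) (ε : Env R) (r : R) :
    f (ε • r) = bimoduleAction f ε (f r) := by
  rw [env_smul_eq_bimoduleAction, map_bimoduleAction, RingHom.comp_id]

@[simp]
theorem inl_smul (a r : R) : inl a • r = a * r := by
  simp [env_smul_eq_bimoduleAction]

@[simp]
theorem inr_smul (b : Rᵐᵒᵖ) (r : R) : inr b • r = r * b.unop := by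
  simp [env_smul_eq_bimoduleAction]

end Bimodule

/-! ### Recognizing symmetric rings of quotients -/

section Recognition

variable {R Q : Type*} [Ring R] [Ring Q] {F : Set (Ideal (Env R))}

/-- An element with annihilator in `F` is sent by `q` to a torsion element of `Q`. This removes the
quotient `R / t(R)` from all later arguments. -/
theorem torsion_eq_bot {q : R →+* Q} (hq : Function.Injective q)
    (htors : ∀ K ∈ F, ∀ x : Q, (∀ κ ∈ K, bimoduleAction q κ x = 0) → x = 0) :
    torsion F R = ⊥ := by
  rw [torsion, Submodule.span_eq_bot]
  intro m hm
  refine hq ((htors _ hm _ fun κ hκ => ?_).trans (map_zero q).symm)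
  rw [← map_env_smul, show κ • m = 0 from hκ, map_zero]

theorem FilterIndex.isDirected (hF : IsGabriel F) : IsDirectedOrder (FilterIndex F) :=
  ⟨fun K L => ⟨OrderDual.toDual ⟨K.ideal ⊓ L.ideal,
    hF.inf_mem _ _ (OrderDual.ofDual K).2 (OrderDual.ofDual L).2⟩,
    (inf_le_left : K.ideal ⊓ L.ideal ≤ K.ideal), (inf_le_right : K.ideal ⊓ L.ideal ≤ L.ideal)⟩⟩

/-- Since `q` is injective, preimages chosen pointwise are automatically linear. This gives
surjectivity of the map from the module of quotients to `Q`. -/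
theorem exists_linearMap_of_mem_range {q : R →+* Q} (hq : Function.Injective q) {s : Q}
    {K : Ideal (Env R)} (h : ∀ κ ∈ K, bimoduleAction q κ s ∈ Set.range q) :
    ∃ φ : K →ₗ[Env R] R, ∀ κ : K, q (φ κ) = bimoduleAction q κ s := by
  choose ρ hρ using fun κ : K => h κ κ.2
  refine ⟨{ toFun := ρ, map_add' := fun κ κ' => hq ?_, map_smul' := fun ε κ => hq ?_ }, hρ⟩
  · rw [hρ, map_add, hρ, hρ, Submodule.coe_add, map_add, LinearMap.add_apply]
  · rw [hρ, RingHom.id_apply, map_env_smul, hρ, ← bimoduleAction_mul]; rfl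

open Classical in
/-- The isomorphism takes the class of `φ` to the element of `Q` whose action is `φ`. -/
theorem exists_quotients_addEquiv (hF : IsGabriel F) {q : R →+* Q}
    (htors : ∀ K ∈ F, ∀ x : Q, (∀ κ ∈ K, bimoduleAction q κ x = 0) → x = 0)
    (hlift : ∀ K ∈ F, ∀ φ : K →ₗ[Env R] R, ∃ s : Q, ∀ κ : K, bimoduleAction q κ s = q (φ κ))
    (hden : ∀ s : Q, ∃ K ∈ F, ∀ κ ∈ K, bimoduleAction q κ s ∈ Set.range q)
    (hq : Function.Injective q) (β : (R ⧸ torsion F R) ≃ₗ[Env R] R) :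
    ∃ e : Quotients F R ≃+ Q, ∀ (K : Ideal (Env R)) (hK : K ∈ F)
      (φ : K →ₗ[Env R] R ⧸ torsion F R) (κ : K),
      bimoduleAction q κ (e (Quotients.mk hK φ)) = q (β (φ κ)) := by
  have uniq {K : Ideal (Env R)} (hK : K ∈ F) {s t : Q}
      (h : ∀ κ : K, bimoduleAction q κ s = bimoduleAction q κ t) : s = t :=
    sub_eq_zero.1 (htors K hK _ fun κ hκ => by rw [map_sub, h ⟨κ, hκ⟩, sub_self])
  -- `σ K φ` is the element of `Q` whose action on `K` is `φ`. Its uniqueness yields both additivity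
  -- in `φ` and compatibility with restriction.
  choose σ hσ using fun (K : FilterIndex F) (φ : K.ideal →ₗ[Env R] R ⧸ torsion F R) =>
    hlift K.ideal (OrderDual.ofDual K).2 (β.toLinearMap.comp φ)
  have hσ' {K : FilterIndex F} {φ : K.ideal →ₗ[Env R] R ⧸ torsion F R} {s : Q}
      (h : ∀ κ : K.ideal, bimoduleAction q κ s = q (β (φ κ))) : σ K φ = s :=
    uniq (OrderDual.ofDual K).2 fun κ => (hσ K φ κ).trans (h κ).symm
  let g (K : FilterIndex F) : (K.ideal →ₗ[Env R] R ⧸ torsion F R) →+ Q :=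
    { toFun := σ K
      map_zero' := hσ' fun κ => by simp
      map_add' := fun φ ψ => hσ' fun κ => by
        rw [map_add, hσ, hσ, LinearMap.add_apply, map_add, map_add]; rfl }
  have hg : ∀ (K K' : FilterIndex F) (h : K ≤ K') (φ), g K' (restrictHom F R K K' h φ) = g K φ :=
    fun K K' h φ => hσ' fun κ => hσ K φ (Submodule.inclusion h κ)
  have : IsDirectedOrder (FilterIndex F) := FilterIndex.isDirected hF
  let e₀ : Quotients F R →+ Q := AddCommGroup.DirectLimit.lift
    (fun K : FilterIndex F => (K.ideal →ₗ[Env R] R ⧸ torsion F R)) (restrictHom F R) Q g hg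
  have he₀ {K : Ideal (Env R)} (hK : K ∈ F) (φ : K →ₗ[Env R] R ⧸ torsion F R) :
      e₀ (Quotients.mk hK φ) = σ (OrderDual.toDual ⟨K, hK⟩) φ :=
    AddCommGroup.DirectLimit.lift_of (f := restrictHom F R) Q g hg _ _
  have hspec {K : Ideal (Env R)} (hK : K ∈ F) (φ : K →ₗ[Env R] R ⧸ torsion F R) (κ : K) :
      bimoduleAction q κ (e₀ (Quotients.mk hK φ)) = q (β (φ κ)) := by
    rw [he₀]; exact hσ (OrderDual.toDual ⟨K, hK⟩) φ κ
  have hspec' {K : Ideal (Env R)} (hK : K ∈ F) (φ : K →ₗ[Env R] R ⧸ torsion F R) (s : Q)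
      (h : ∀ κ : K, bimoduleAction q κ s = q (β (φ κ))) : e₀ (Quotients.mk hK φ) = s :=
    uniq hK fun κ => (hspec hK φ κ).trans (h κ).symm
  have hinj : Function.Injective e₀ := by
    refine AddCommGroup.DirectLimit.lift_injective (f := restrictHom F R) Q g hg
      fun K => (injective_iff_map_eq_zero _).2 fun φ hφ => LinearMap.ext fun κ => ?_
    have := hσ K φ κ
    rw [show σ K φ = 0 from hφ, map_zero] at this
    exact β.injective (hq (by simpa using this.symm))
  have hsurj : Function.Surjective e₀ := fun s => by
    obtain ⟨K, hK, h⟩ := hden s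
    obtain ⟨φ, hφ⟩ := exists_linearMap_of_mem_range hq h
    refine ⟨Quotients.mk hK (β.symm.toLinearMap.comp φ), hspec' _ _ _ fun κ => ?_⟩
    rw [← hφ]; exact congrArg q (β.apply_symm_apply _).symm
  exact ⟨AddEquiv.ofBijective e₀ ⟨hinj, hsurj⟩, fun K hK => hspec hK⟩

/-- `Q` is the symmetric ring of quotients of `R` as soon as it is torsion-free, every bimodule
homomorphism `K → R` with `K ∈ F` is the action on an element of `Q`, and every element of `Q` is
carried into `R` by an ideal in `F`. -/
theorem isSymmetricRingOfQuotients_of_torsionFree {Fl : Set (Ideal R)} {Fr : Set (Ideal Rᵐᵒᵖ)}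
    {q : R →+* Q} (hFl : IsGabriel Fl) (hFr : IsGabriel Fr) (hF : IsGabriel F)
    (hq : Function.Injective q)
    (htors : ∀ K ∈ F, ∀ x : Q, (∀ κ ∈ K, bimoduleAction q κ x = 0) → x = 0)
    (hlift : ∀ K ∈ F, ∀ φ : K →ₗ[Env R] R, ∃ s : Q, ∀ κ : K, bimoduleAction q κ s = q (φ κ))
    (hden : ∀ s : Q, ∃ K ∈ F, ∀ κ ∈ K, bimoduleAction q κ s ∈ Set.range q)
    (hmul : ∀ I ∈ Fl, ∀ x : Q, (∀ i ∈ I, q i * x = 0) → x = 0) :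
    IsSymmetricRingOfQuotients F Fl Fr q := by
  have htb := torsion_eq_bot hq htors
  obtain ⟨β, hβ⟩ : ∃ β : (R ⧸ torsion F R) ≃ₗ[Env R] R, ∀ r, β ((torsion F R).mkQ r) = r :=
    ⟨Submodule.quotEquivOfEqBot _ htb, Submodule.quotEquivOfEqBot_apply_mk _ htb⟩
  have uniq {K : Ideal (Env R)} (hK : K ∈ F) {s t : Q}
      (h : ∀ κ : K, bimoduleAction q κ s = bimoduleAction q κ t) : s = t :=
    sub_eq_zero.1 (htors K hK _ fun κ hκ => by rw [map_sub, h ⟨κ, hκ⟩, sub_self])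
  obtain ⟨e, he⟩ := exists_quotients_addEquiv hF htors hlift hden hq β
  have hspec {K : Ideal (Env R)} (hK : K ∈ F) := he K hK
  have hspec' {K : Ideal (Env R)} (hK : K ∈ F) (φ : K →ₗ[Env R] R ⧸ torsion F R) (s : Q)
      (h : ∀ κ : K, bimoduleAction q κ s = q (β (φ κ))) : e (Quotients.mk hK φ) = s :=
    uniq hK fun κ => (hspec hK φ κ).trans (h κ).symm
  refine ⟨hFl, hFr, hF, e, ?_, ?_, ?_⟩
  · intro K hK r
    refine hspec' hK _ _ fun κ => ?_
    rw [← map_env_smul]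
    exact congrArg q (hβ _).symm
  · intro K K' hK hK' φ ψ ε h
    refine hspec' hK' _ _ fun κ => ?_
    obtain ⟨h, hκ⟩ := h κ
    rw [hκ, ← bimoduleAction_mul]
    exact hspec hK φ ⟨_, h⟩
  · intro K₁ K₂ K hK₁ hK₂ hK φ₁ φ₂ χ hp
    obtain ⟨⟨I, hI, hp⟩, -⟩ := hp
    -- With `x₁`, `x₂`, `x` the images of the three classes, `i x₁ = i'` and `i x = i' x₂ = i x₁
    -- x₂`, so `I` kills `x - x₁ x₂`.
    refine sub_eq_zero.1 (hmul I hI _ fun i hi => ?_)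
    obtain ⟨i', h₁, h₂, h, e₁, e₂⟩ := hp i hi
    have t₁ : bimoduleAction q (inl i) _ = _ := hspec hK₁ φ₁ ⟨_, h₁⟩
    have t₂ : bimoduleAction q (inl i') _ = _ := hspec hK₂ φ₂ ⟨_, h₂⟩
    have t : bimoduleAction q (inl i) _ = _ := hspec hK χ ⟨_, h⟩
    rw [e₁, hβ, bimoduleAction_inl] at t₁
    rw [e₂, ← t₂, bimoduleAction_inl, bimoduleAction_inl] at t
    rw [mul_sub, ← mul_assoc, t₁, t, sub_self]

/-- Moves the criterion to an ambient ring `S`, where the cancellation arguments take place.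
Membership in `T` matters only for lifts and denominators. -/
theorem isSymmetricRingOfQuotients_subring {S : Type*} [Ring S] {Fl : Set (Ideal R)}
    {Fr : Set (Ideal Rᵐᵒᵖ)} {f : R →+* S} {T : Subring S} {q : R →+* T}
    (hq : T.subtype.comp q = f) (hf : Function.Injective f)
    (hFl : IsGabriel Fl) (hFr : IsGabriel Fr) (hF : IsGabriel F)
    (htors : ∀ K ∈ F, ∀ x : S, (∀ κ ∈ K, bimoduleAction f κ x = 0) → x = 0)
    (hlift : ∀ K ∈ F, ∀ φ : K →ₗ[Env R] R, ∃ s ∈ T, ∀ κ : K, bimoduleAction f κ s = f (φ κ))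
    (hden : ∀ s ∈ T, ∃ K ∈ F, ∀ κ ∈ K, bimoduleAction f κ s ∈ Set.range f)
    (hmul : ∀ I ∈ Fl, ∀ x : S, (∀ i ∈ I, f i * x = 0) → x = 0) :
    IsSymmetricRingOfQuotients F Fl Fr q := by
  subst hq
  have key (κ : Env R) (x : T) :
      ((bimoduleAction q κ x : T) : S) = bimoduleAction (T.subtype.comp q) κ (x : S) :=
    map_bimoduleAction q T.subtype κ x
  refine isSymmetricRingOfQuotients_of_torsionFree hFl hFr hF (fun a b h => hf ?_) ?_ ?_ ?_ ?_
  · exact congrArg T.subtype h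
  · exact fun K hK x hx => Subtype.ext (htors K hK x fun κ hκ => by rw [← key, hx κ hκ]; rfl)
  · intro K hK φ
    obtain ⟨s, hs, h⟩ := hlift K hK φ
    exact ⟨⟨s, hs⟩, fun κ => Subtype.ext (by rw [key]; exact h κ)⟩
  · rintro ⟨s, hs⟩
    obtain ⟨K, hK, h⟩ := hden s hs
    refine ⟨K, hK, fun κ hκ => ?_⟩
    obtain ⟨r, hr⟩ := h κ hκ
    exact ⟨r, Subtype.ext (by rw [key]; exact hr)⟩
  · exact fun I hI x hx => Subtype.ext (hmul I hI x fun i hi => congrArg T.subtype (hx i hi))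

end Recognition

/-! ### Ideals generating the unit ideal -/

section Denominators

variable {A B : Type*} [Ring A] [Ring B]

theorem mem_colon {I : Ideal A} {r a : A} : a ∈ colon I r ↔ a * r ∈ I := Iff.rfl

theorem colon_one (I : Ideal A) : colon I 1 = I := by
  ext; simp [mem_colon]

theorem colon_colon (I : Ideal A) (r s : A) : colon (colon I r) s = colon I (s * r) := by
  ext; simp [mem_colon, mul_assoc]

theorem colon_inf (I J : Ideal A) (r : A) : colon (I ⊓ J) r = colon I r ⊓ colon J r := rfl

theorem colon_mono {I J : Ideal A} (h : I ≤ J) (r : A) : colon I r ≤ colon J r :=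
  fun _ ha => h ha

theorem map_eq_top_mono {f : A →+* B} {I J : Ideal A} (h : I ≤ J) (hI : I.map f = ⊤) :
    J.map f = ⊤ :=
  top_le_iff.1 (hI ▸ Ideal.map_mono h)

/-- Multiplying `1 ∈ B f((I : a))` on the right by `f a` gives `f a ∈ B f(I)`. Hence `B f(I)`
contains `B f(J) = B`. -/
theorem map_eq_top_of_colon {f : A →+* B} {I J : Ideal A} (hJ : J.map f = ⊤)
    (h : ∀ a ∈ J, (colon I a).map f = ⊤) : I.map f = ⊤ := by
  refine top_le_iff.1 (hJ ▸ Ideal.map_le_iff_le_comap.2 fun a ha => ?_)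
  have key : (colon I a).map f ≤ Submodule.comap (LinearMap.toSpanSingleton B B (f a)) (I.map f) :=
    Ideal.span_le.2 <| by
      rintro _ ⟨x, hx, rfl⟩
      change f x * f a ∈ I.map f
      rw [← map_mul]
      exact Ideal.mem_map_of_mem f hx
  have := key (h a ha ▸ Submodule.mem_top : (1 : B) ∈ (colon I a).map f)
  simpa using this

/-- If `f(I)` generates the unit left ideal, it annihilates no nonzero element. -/
theorem eq_zero_of_map_eq_top {f : A →+* B} {I : Ideal A} (hI : I.map f = ⊤) {M : Type*}
    [AddCommGroup M] [Module B M] {x : M} (h : ∀ i ∈ I, f i • x = 0) : x = 0 := by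
  have : I.map f ≤ LinearMap.ker (LinearMap.toSpanSingleton B M x) :=
    Ideal.span_le.2 (by rintro _ ⟨i, hi, rfl⟩; exact h i hi)
  have := this (hI ▸ Submodule.mem_top : (1 : B) ∈ I.map f)
  simpa using this

/-- The ideals `I` with `B f((I : r)) = B` for all `r`. -/
def denomFilter (f : A →+* B) : Set (Ideal A) :=
  {I | ∀ r, (colon I r).map f = ⊤}

theorem map_eq_top_of_mem_denomFilter {f : A →+* B} {I : Ideal A} (h : I ∈ denomFilter f) :
    I.map f = ⊤ :=
  colon_one I ▸ h 1

theorem isGabriel_denomFilter (f : A →+* B) : IsGabriel (denomFilter f) where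
  top_mem r := Ideal.map_top f
  mem_of_le I J hI h r := map_eq_top_mono (colon_mono h r) (hI r)
  inf_mem I J hI hJ r := map_eq_top_of_colon (hI r) fun a ha => by
    have h : a * r ∈ I := ha
    rw [colon_inf, colon_inf, colon_colon, colon_colon]
    -- As `a * r` lies in `I`, so does `b * (a * r)`; only the condition for `J` remains.
    refine map_eq_top_mono (le_inf (fun b _ => ?_) le_rfl) (hJ (a * r))
    rw [mem_colon, ← mul_assoc, mul_assoc]
    exact I.mul_mem_left b h
  colon_mem I hI r s := by rw [colon_colon]; exact hI _
  mem_of_colon J hJ I h r := map_eq_top_of_colon (hJ r) fun a ha => by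
    rw [colon_colon, ← colon_one (colon I (a * r))]
    exact h (a * r) ha 1

/-- `{a | f a * s ∈ f(A)}`. -/
def denomIdeal (f : A →+* B) (s : B) : Ideal A where
  carrier := {a | f a * s ∈ f.range}
  add_mem' {a b} ha hb := by
    simp only [Set.mem_ofPred_eq, map_add, add_mul] at *; exact add_mem ha hb
  zero_mem' := by simp only [Set.mem_ofPred_eq, map_zero, zero_mul]; exact zero_mem f.range
  smul_mem' c a ha := by
    simp only [Set.mem_ofPred_eq, smul_eq_mul, map_mul, mul_assoc] at *
    exact mul_mem (RingHom.mem_range_self f c) ha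

theorem mem_denomIdeal {f : A →+* B} {s : B} {a : A} : a ∈ denomIdeal f s ↔ f a * s ∈ f.range :=
  Iff.rfl

theorem colon_denomIdeal (f : A →+* B) (s : B) (r : A) :
    colon (denomIdeal f s) r = denomIdeal f (f r * s) := by
  ext; simp [mem_colon, mem_denomIdeal, mul_assoc]

/-- The elements `s` with `B f((f(A) : f(r) s)) = B` for all `r`. -/
def denomSubring (f : A →+* B) : Subring B where
  carrier := {s | denomIdeal f s ∈ denomFilter f}
  mul_mem' {s t} hs ht r := by
    -- If `f (a r) s = f b`, then a denominator `c` of `f b * t` makes `c a r` a denominator of `s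
    -- t`.
    refine map_eq_top_of_colon (hs r) fun a ha => ?_
    obtain ⟨b, hb⟩ := ha
    refine map_eq_top_mono (fun c hc => ?_) (ht b)
    rw [colon_denomIdeal] at hc
    change f (c * a * r) * (s * t) ∈ f.range
    rw [mem_denomIdeal, hb] at hc
    simpa [mul_assoc] using hc
  one_mem' r := map_eq_top_mono (fun a _ => by
    change f (a * r) * 1 ∈ f.range
    rw [mul_one]; exact RingHom.mem_range_self f _) (Ideal.map_top f)
  add_mem' {s t} hs ht := (isGabriel_denomFilter f).mem_of_le _ _
    ((isGabriel_denomFilter f).inf_mem _ _ hs ht) fun a ha => by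
      rw [mem_denomIdeal, mul_add]; exact add_mem ha.1 ha.2
  zero_mem' := (isGabriel_denomFilter f).mem_of_le _ _ (isGabriel_denomFilter f).top_mem
    fun a _ => by simp [mem_denomIdeal]
  neg_mem' {s} hs := (isGabriel_denomFilter f).mem_of_le _ _ hs fun a ha => by
      rw [mem_denomIdeal, mul_neg]; exact neg_mem ha

theorem range_le_denomSubring (f : A →+* B) : f.range ≤ denomSubring f := by
  rintro _ ⟨a, rfl⟩
  refine (isGabriel_denomFilter f).mem_of_le _ _ (isGabriel_denomFilter f).top_mem fun b _ => ?_
  rw [mem_denomIdeal, ← map_mul]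
  exact RingHom.mem_range_self f _

/-- The elements of `B` with denominators on both sides. -/
def symDenomSubring (f : A →+* B) : Subring B :=
  denomSubring f ⊓ (denomSubring (RingHom.op f)).unop

theorem range_le_symDenomSubring (f : A →+* B) : f.range ≤ symDenomSubring f := by
  rintro _ ⟨a, rfl⟩
  exact ⟨range_le_denomSubring f ⟨a, rfl⟩,
    range_le_denomSubring (RingHom.op f) ⟨MulOpposite.op a, rfl⟩⟩

end Denominators

/-! ### Induced filters -/

section Induced

variable {R : Type*} [Ring R]

/-- `a ↦ a ⊗ 1`. -/
def inlHom (R : Type*) [Ring R] : R →+* Env R :=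
  Algebra.TensorProduct.includeLeftRingHom

/-- `b ↦ 1 ⊗ b`. -/
def inrHom (R : Type*) [Ring R] : Rᵐᵒᵖ →+* Env R :=
  (Algebra.TensorProduct.includeRight : Rᵐᵒᵖ →ₐ[ℤ] Env R).toRingHom

theorem inlHom_apply (a : R) : inlHom R a = inl a := rfl

theorem inrHom_apply (b : Rᵐᵒᵖ) : inrHom R b = inr b := rfl

/-- The contractions of `K` to the two factors are the largest possible `I` and `J`. -/
theorem mem_inducedFilter {Fl : Set (Ideal R)} {Fr : Set (Ideal Rᵐᵒᵖ)} (hl : IsGabriel Fl)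
    (hr : IsGabriel Fr) {K : Ideal (Env R)} :
    K ∈ inducedFilter Fl Fr ↔ K.comap (inlHom R) ∈ Fl ∧ K.comap (inrHom R) ∈ Fr := by
  constructor
  · rintro ⟨I, hI, J, hJ, h⟩
    rw [sup_le_iff, Ideal.span_le, Ideal.span_le] at h
    exact ⟨hl.mem_of_le _ _ hI fun a ha => h.1 ⟨a, ha, rfl⟩,
      hr.mem_of_le _ _ hJ fun a ha => h.2 ⟨a, ha, rfl⟩⟩
  · rintro ⟨hI, hJ⟩
    refine ⟨_, hI, _, hJ, sup_le (Ideal.span_le.2 ?_) (Ideal.span_le.2 ?_)⟩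
    · rintro _ ⟨a, ha, rfl⟩; exact ha
    · rintro _ ⟨a, ha, rfl⟩; exact ha

theorem IsGabriel.comap_colon_mem {A E : Type*} [Ring A] [Ring E] {F : Set (Ideal A)}
    (hF : IsGabriel F) {g : A →+* E} {K : Ideal E} {ε η : E}
    (h : (colon K ε).comap g ∈ F) (h' : (colon K η).comap g ∈ F) :
    (colon K (ε + η)).comap g ∈ F :=
  hF.mem_of_le _ _ (hF.inf_mem _ _ h h') fun a ha => by
    change g a * (ε + η) ∈ K
    rw [mul_add]
    exact add_mem ha.1 ha.2

/-- For `(K : ε)` it suffices to treat pure tensors. There the two factors commute, so `(c ⊗ 1)(a ⊗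
b) = (1 ⊗ b)(ca ⊗ 1)`, and `c ∈ (I : a)` is enough. -/
theorem isGabriel_inducedFilter {Fl : Set (Ideal R)} {Fr : Set (Ideal Rᵐᵒᵖ)}
    (hl : IsGabriel Fl) (hr : IsGabriel Fr) : IsGabriel (inducedFilter Fl Fr) where
  top_mem := (mem_inducedFilter hl hr).2 ⟨hl.top_mem, hr.top_mem⟩
  mem_of_le K L hK h := by
    rw [mem_inducedFilter hl hr] at *
    exact ⟨hl.mem_of_le _ _ hK.1 (Ideal.comap_mono h), hr.mem_of_le _ _ hK.2 (Ideal.comap_mono h)⟩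
  inf_mem K L hK hL := by
    rw [mem_inducedFilter hl hr] at *
    exact ⟨hl.inf_mem _ _ hK.1 hL.1, hr.inf_mem _ _ hK.2 hL.2⟩
  colon_mem K hK ε := by
    rw [mem_inducedFilter hl hr] at *
    constructor
    · induction ε using Env.induction_on with
      | tmul a b =>
        refine hl.mem_of_le _ _ (hl.colon_mem _ hK.1 a) fun c hc => ?_
        have : inlHom R c * (a ⊗ₜ b : Env R) = inrHom R b * inlHom R (c * a) := by
          simp [inlHom_apply, inrHom_apply, inl, inr]
        change inlHom R c * (a ⊗ₜ b : Env R) ∈ K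
        rw [this]
        exact K.mul_mem_left _ hc
      | add ε η h h' => exact hl.comap_colon_mem h h'
    · induction ε using Env.induction_on with
      | tmul a b =>
        refine hr.mem_of_le _ _ (hr.colon_mem _ hK.2 b) fun c hc => ?_
        have : inrHom R c * (a ⊗ₜ b : Env R) = inlHom R a * inrHom R (c * b) := by
          simp [inlHom_apply, inrHom_apply, inl, inr]
        change inrHom R c * (a ⊗ₜ b : Env R) ∈ K
        rw [this]
        exact K.mul_mem_left _ hc
      | add ε η h h' => exact hr.comap_colon_mem h h'
  mem_of_colon L hL K h := by
    simp only [mem_inducedFilter hl hr] at *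
    refine ⟨hl.mem_of_colon _ hL.1 _ fun a ha => hl.mem_of_le _ _ (h _ ha).1 fun b hb => ?_,
      hr.mem_of_colon _ hL.2 _ fun a ha => hr.mem_of_le _ _ (h _ ha).2 fun b hb => ?_⟩
    · change inlHom R (b * a) ∈ K
      rw [map_mul]; exact hb
    · change inrHom R (b * a) ∈ K
      rw [map_mul]; exact hb

end Induced

/-! ### The symmetric ring of quotients of the induced torsion theory -/

section InducedQuotients

variable {R S : Type*} [Ring R] [Ring S]

theorem mul_eq_zero_right_of_map_eq_top {f : R →+* S} {J : Ideal Rᵐᵒᵖ}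
    (hJ : J.map (RingHom.op f) = ⊤) {x : S} (h : ∀ j ∈ J, x * f j.unop = 0) : x = 0 :=
  MulOpposite.op_injective <| eq_zero_of_map_eq_top (M := Sᵐᵒᵖ) hJ fun j hj =>
    congrArg MulOpposite.op (h j hj)

theorem mem_denomIdeal_op {f : R →+* S} {s : S} {b : Rᵐᵒᵖ} :
    b ∈ denomIdeal (RingHom.op f) (MulOpposite.op s) ↔ s * f b.unop ∈ f.range :=
  ⟨fun ⟨c, hc⟩ => ⟨c.unop, congrArg MulOpposite.unop hc⟩,
    fun ⟨c, hc⟩ => ⟨MulOpposite.op c, congrArg MulOpposite.op hc⟩⟩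

/-- The elements of the enveloping ring that carry `s` into `f(R)`. -/
def envDenomIdeal (f : R →+* S) (s : S) : Ideal (Env R) where
  carrier := {κ | bimoduleAction f κ s ∈ f.range}
  add_mem' {a b} ha hb := by
    simp only [Set.mem_ofPred_eq, map_add, LinearMap.add_apply] at *; exact add_mem ha hb
  zero_mem' := by
    simp only [Set.mem_ofPred_eq, map_zero, LinearMap.zero_apply]; exact zero_mem f.range
  smul_mem' ε κ hκ := by
    obtain ⟨r, hr⟩ := hκ
    refine ⟨ε • r, ?_⟩
    rw [map_env_smul, hr, smul_eq_mul, bimoduleAction_mul]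

theorem mem_envDenomIdeal {f : R →+* S} {s : S} {κ : Env R} :
    κ ∈ envDenomIdeal f s ↔ bimoduleAction f κ s ∈ f.range := Iff.rfl

theorem comap_inlHom_envDenomIdeal (f : R →+* S) (s : S) :
    (envDenomIdeal f s).comap (inlHom R) = denomIdeal f s := by
  ext a
  rw [Ideal.mem_comap, mem_envDenomIdeal, inlHom_apply, bimoduleAction_inl, mem_denomIdeal]

theorem comap_inrHom_envDenomIdeal (f : R →+* S) (s : S) :
    (envDenomIdeal f s).comap (inrHom R) = denomIdeal (RingHom.op f) (MulOpposite.op s) := by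
  ext a
  rw [Ideal.mem_comap, mem_envDenomIdeal, inrHom_apply, bimoduleAction_inr, mem_denomIdeal_op]

theorem envDenomIdeal_mem_inducedFilter {f : R →+* S} {s : S} (hs : s ∈ symDenomSubring f) :
    envDenomIdeal f s ∈ inducedFilter (denomFilter f) (denomFilter (RingHom.op f)) := by
  rw [mem_inducedFilter (isGabriel_denomFilter _) (isGabriel_denomFilter _),
    comap_inlHom_envDenomIdeal, comap_inrHom_envDenomIdeal]
  exact hs

/-- The part of `K` on which `φ` is the action on `s`. -/
def envEqLocus (f : R →+* S) {K : Ideal (Env R)} (φ : K →ₗ[Env R] R) (s : S) :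
    Ideal (Env R) where
  carrier := {κ | ∃ h : κ ∈ K, bimoduleAction f κ s = f (φ ⟨κ, h⟩)}
  add_mem' := by
    rintro a b ⟨ha, ha'⟩ ⟨hb, hb'⟩
    refine ⟨add_mem ha hb, ?_⟩
    rw [map_add, LinearMap.add_apply, ha', hb', ← map_add, ← map_add]; rfl
  zero_mem' := ⟨zero_mem K, by
    rw [map_zero, LinearMap.zero_apply]
    exact ((congrArg f (map_zero φ)).trans (map_zero f)).symm⟩
  smul_mem' := by
    rintro ε κ ⟨h, h'⟩
    refine ⟨K.mul_mem_left ε h, ?_⟩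
    exact (bimoduleAction_mul f ε κ s).trans (by rw [h', ← map_env_smul, ← map_smul]; rfl)

theorem eq_zero_of_mem_inducedFilter {f : R →+* S} {K : Ideal (Env R)}
    (hK : K ∈ inducedFilter (denomFilter f) (denomFilter (RingHom.op f))) {x : S}
    (h : ∀ κ ∈ K, bimoduleAction f κ x = 0) : x = 0 := by
  rw [mem_inducedFilter (isGabriel_denomFilter _) (isGabriel_denomFilter _)] at hK
  refine eq_zero_of_map_eq_top (M := S) (map_eq_top_of_mem_denomFilter hK.1) fun i hi => ?_
  rw [smul_eq_mul, ← bimoduleAction_inl]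
  exact h _ hi

/-- From `1 = ∑ b_k f(i_k)` put `s = ∑ b_k f(g(i_k))`. Then `s f(j) = ∑ b_k f(i_k) f(g'(j)) =
f(g'(j))`. The induction allows any `y ∈ S f(I)` in place of `1`. -/
theorem exists_mul_eq_of_compatible {f : R →+* S} {I : Ideal R} {J : Ideal Rᵐᵒᵖ} (g : I → R)
    (g' : J → R) (h : ∀ (i : I) (j : J), g i * (j : Rᵐᵒᵖ).unop = i * g' j)
    (hI : I.map f = ⊤) : ∃ s, ∀ j : J, s * f (j : Rᵐᵒᵖ).unop = f (g' j) := by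
  suffices ∀ y ∈ I.map f, ∃ s, ∀ j : J, s * f (j : Rᵐᵒᵖ).unop = y * f (g' j) by
    simpa using this 1 (hI ▸ Submodule.mem_top)
  intro y hy
  induction hy using Submodule.span_induction with
  | mem x hx =>
    obtain ⟨i, hi, rfl⟩ := hx
    exact ⟨f (g ⟨i, hi⟩), fun j => by rw [← map_mul, ← map_mul, h]⟩
  | zero => exact ⟨0, fun j => by simp⟩
  | add x y _ _ hx hy =>
    obtain ⟨s, hs⟩ := hx
    obtain ⟨t, ht⟩ := hy
    exact ⟨s + t, fun j => by rw [add_mul, add_mul, hs, ht]⟩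
  | smul a x _ hx =>
    obtain ⟨s, hs⟩ := hx
    exact ⟨a * s, fun j => by rw [mul_assoc, hs, smul_eq_mul, mul_assoc]⟩

theorem exists_mem_symDenomSubring_of_mem_inducedFilter {f : R →+* S} {K : Ideal (Env R)}
    (hK : K ∈ inducedFilter (denomFilter f) (denomFilter (RingHom.op f)))
    (φ : K →ₗ[Env R] R) :
    ∃ s ∈ symDenomSubring f, ∀ κ : K, bimoduleAction f κ s = f (φ κ) := by
  have hl := isGabriel_denomFilter f
  have hr := isGabriel_denomFilter (RingHom.op f)
  have hK' := hK
  rw [mem_inducedFilter hl hr] at hK'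
  obtain ⟨hI, hJ⟩ := hK'
  let g (i : K.comap (inlHom R)) : R := φ ⟨inl i, i.2⟩
  let g' (j : K.comap (inrHom R)) : R := φ ⟨inr j, j.2⟩
  have hg (i : K.comap (inlHom R)) (j : K.comap (inrHom R)) :
      g i * (j : Rᵐᵒᵖ).unop = i * g' j := by
    rw [← inr_smul, ← inl_smul, ← map_smul, ← map_smul]
    refine congrArg φ (Subtype.ext ?_)
    simp [inl, inr]
  obtain ⟨s, hs⟩ := exists_mul_eq_of_compatible g g' hg (map_eq_top_of_mem_denomFilter hI)
  -- After right multiplication by `f j` both sides become `f (i g'(j))`, and `J` can be cancelled.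
  have hs' (i : K.comap (inlHom R)) : f i * s = f (g i) := by
    refine sub_eq_zero.1 (mul_eq_zero_right_of_map_eq_top (map_eq_top_of_mem_denomFilter hJ)
      fun j hj => ?_)
    rw [sub_mul, mul_assoc, hs ⟨j, hj⟩, ← map_mul, ← map_mul, hg i ⟨j, hj⟩, sub_self]
  have hL : envEqLocus f φ s ∈ inducedFilter (denomFilter f) (denomFilter (RingHom.op f)) :=
    (mem_inducedFilter hl hr).2
      ⟨hl.mem_of_le _ _ hI fun i hi => ⟨hi, (bimoduleAction_inl _ _ _).trans (hs' ⟨i, hi⟩)⟩,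
        hr.mem_of_le _ _ hJ fun j hj => ⟨hj, (bimoduleAction_inr _ _ _).trans (hs ⟨j, hj⟩)⟩⟩
  refine ⟨s, ⟨hl.mem_of_le _ _ hI fun i hi => ⟨_, (hs' ⟨i, hi⟩).symm⟩,
    hr.mem_of_le _ _ hJ fun j hj => mem_denomIdeal_op.2 ⟨_, (hs ⟨j, hj⟩).symm⟩⟩, fun κ => ?_⟩
  -- The locus where `φ` is the action on `s` lies in the filter, hence so does its colon ideal by
  -- `κ`. This colon ideal kills the difference of the two sides at `κ`.
  refine sub_eq_zero.1 (eq_zero_of_mem_inducedFilter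
    ((isGabriel_inducedFilter hl hr).colon_mem _ hL κ) fun ε hε => ?_)
  obtain ⟨h, hε⟩ := hε
  change bimoduleAction f (ε * κ) s = f (φ (ε • κ)) at hε
  rw [map_sub, ← bimoduleAction_mul, hε, ← map_env_smul, ← map_smul, sub_self]

/-- The elements with denominators on both sides form the symmetric ring of quotients with respect
to the induced torsion theory. -/
theorem isSymmetricRingOfQuotients_induced {f : R →+* S} (hf : Function.Injective f)
    {T : Subring S} (hT : T = symDenomSubring f) {q : R →+* T} (hq : T.subtype.comp q = f) :
    IsSymmetricRingOfQuotients (inducedFilter (denomFilter f) (denomFilter (RingHom.op f)))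
      (denomFilter f) (denomFilter (RingHom.op f)) q := by
  have hl := isGabriel_denomFilter f
  have hr := isGabriel_denomFilter (RingHom.op f)
  subst hT
  exact isSymmetricRingOfQuotients_subring hq hf hl hr (isGabriel_inducedFilter hl hr)
    (fun K hK x => eq_zero_of_mem_inducedFilter hK)
    (fun K hK φ => exists_mem_symDenomSubring_of_mem_inducedFilter hK φ)
    (fun s hs => ⟨_, envDenomIdeal_mem_inducedFilter hs, fun κ hκ => hκ⟩)
    (fun I hI x => eq_zero_of_map_eq_top (M := S) (map_eq_top_of_mem_denomFilter hI))

end InducedQuotients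

/-! ### The derived subring -/

section Derived

/-- The additive span of the products already absorbs left multiplication by `j(B)`. This links
`derived` and the two filters to generated ideals. -/
theorem coe_mulSpan_range_left {B S : Type*} [Ring B] [Ring S] (j : B →+* S) (Y : Set B) :
    AddSubgroup.closure {z | ∃ x ∈ Set.range j, ∃ y ∈ j '' Y, z = x * y} =
      (Ideal.span Y).toAddSubgroup.map j.toAddMonoidHom := by
  refine le_antisymm ((AddSubgroup.closure_le _).2 ?_) ?_
  · rintro _ ⟨_, ⟨b, rfl⟩, _, ⟨y, hy, rfl⟩, rfl⟩
    exact ⟨b * y, Ideal.mul_mem_left _ _ (Ideal.subset_span hy), map_mul j b y⟩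
  · rintro _ ⟨y, hy, rfl⟩
    suffices ∀ b, j (b * y) ∈ AddSubgroup.closure {z | ∃ x ∈ Set.range j, ∃ y ∈ j '' Y, z = x * y}
      from one_mul y ▸ this 1
    refine Submodule.span_induction (fun y hy b => ?_) (fun b => ?_) (fun x y _ _ hx hy b => ?_)
      (fun a x _ hx b => ?_) hy
    · exact AddSubgroup.subset_closure ⟨_, ⟨b, rfl⟩, _, ⟨y, hy, rfl⟩, map_mul j b y⟩
    · rw [mul_zero, map_zero]; exact zero_mem _
    · rw [mul_add, map_add]; exact add_mem (hx b) (hy b)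
    · rw [smul_eq_mul, ← mul_assoc]; exact hx _

variable {S : Type u} [Ring S]

theorem mulSpan_range_left_eq_iff {B : Type*} [Ring B] {j : B →+* S}
    (hj : Function.Injective j) (Y : Set B) :
    (mulSpan (Set.range j) (j '' Y) : Set S) = Set.range j ↔ Ideal.span Y = ⊤ := by
  rw [mulSpan, coe_mulSpan_range_left, Ideal.eq_top_iff_one]
  constructor
  · intro h
    obtain ⟨y, hy, hy'⟩ := h.ge ⟨1, rfl⟩
    exact hj hy' ▸ hy
  · intro h
    refine Set.Subset.antisymm ?_ ?_
    · rintro _ ⟨y, -, rfl⟩; exact ⟨y, rfl⟩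
    · rintro _ ⟨y, rfl⟩
      exact ⟨y, by simpa using (Ideal.span Y).mul_mem_left y h, rfl⟩

theorem op_image_mulSpan (X Y : Set S) :
    MulOpposite.op '' (mulSpan X Y : Set S) =
      mulSpan (MulOpposite.op '' Y) (MulOpposite.op '' X) := by
  have := AddMonoidHom.map_closure (MulOpposite.opAddEquiv : S ≃+ Sᵐᵒᵖ).toAddMonoidHom
    {z | ∃ x ∈ X, ∃ y ∈ Y, z = x * y}
  refine (congrArg (fun H : AddSubgroup Sᵐᵒᵖ => (H : Set Sᵐᵒᵖ)) this).trans ?_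
  refine congrArg (fun Z : Set Sᵐᵒᵖ => ((AddSubgroup.closure Z : AddSubgroup Sᵐᵒᵖ) : Set Sᵐᵒᵖ)) (Set.ext fun z => ?_)
  constructor
  · rintro ⟨_, ⟨x, hx, y, hy, rfl⟩, rfl⟩
    exact ⟨_, ⟨y, hy, rfl⟩, _, ⟨x, hx, rfl⟩, rfl⟩
  · rintro ⟨_, ⟨y, hy, rfl⟩, _, ⟨x, hx, rfl⟩, rfl⟩
    exact ⟨_, ⟨x, hx, y, hy, rfl⟩, rfl⟩

theorem mulSpan_range_right_eq_iff {B : Type*} [Ring B] {j : B →+* S}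
    (hj : Function.Injective j) (Y : Set B) :
    (mulSpan (j '' Y) (Set.range j) : Set S) = Set.range j ↔
      Ideal.span (MulOpposite.op '' Y) = ⊤ := by
  have h1 : MulOpposite.op '' Set.range j = Set.range (RingHom.op j) := by
    ext x
    exact ⟨fun ⟨_, ⟨b, hb⟩, h⟩ => ⟨MulOpposite.op b, by rw [← h, ← hb]; rfl⟩,
      fun ⟨b, hb⟩ => ⟨_, ⟨b.unop, rfl⟩, hb⟩⟩
  have h2 : MulOpposite.op '' (j '' Y) = RingHom.op j '' (MulOpposite.op '' Y) := by
    rw [Set.image_image, Set.image_image]; rfl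
  rw [← (Set.image_injective.2 MulOpposite.op_injective).eq_iff, op_image_mulSpan, h1, h2]
  exact mulSpan_range_left_eq_iff (j := RingHom.op j)
    (fun a b h => MulOpposite.unop_injective (hj (MulOpposite.op_injective h))) _

variable (R : Subring S)

theorem leftFilter_eq : leftFilter R = denomFilter R.subtype := by
  refine Set.ext fun I => forall_congr' fun r => ?_
  have := mulSpan_range_left_eq_iff (j := RingHom.id S) Function.injective_id
    (R.subtype '' (colon I r : Set R))
  rw [show Set.range (RingHom.id S) = Set.univ from Set.range_id,
    show RingHom.id S '' (R.subtype '' (colon I r : Set R)) =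
      {x : S | ∃ a : R, a * r ∈ I ∧ x = a} from
      Set.ext fun x => by simp [mem_colon, eq_comm], ← AddSubgroup.coe_top, SetLike.coe_set_eq]
    at this
  exact this

theorem rightFilter_eq : rightFilter R = denomFilter (RingHom.op R.subtype) := by
  refine Set.ext fun J => ((MulOpposite.opEquiv (α := R)).forall_congr fun r => ?_)
  have := mulSpan_range_right_eq_iff (j := RingHom.id S) Function.injective_id
    {x : S | ∃ a : R, MulOpposite.op (r * a) ∈ J ∧ x = a}
  rw [show Set.range (RingHom.id S) = Set.univ from Set.range_id,
    show RingHom.id S '' _ = _ from Set.image_id _, ← AddSubgroup.coe_top, SetLike.coe_set_eq,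
    show MulOpposite.op '' {x : S | ∃ a : R, MulOpposite.op (r * a) ∈ J ∧ x = a} =
      RingHom.op R.subtype '' (colon J (MulOpposite.op r) : Set (R : Type u)ᵐᵒᵖ) from
      Set.ext fun x => ⟨fun ⟨_, ⟨a, h, h'⟩, h''⟩ => ⟨MulOpposite.op a, h, by rw [← h'', h']; rfl⟩,
        fun ⟨a, h, h'⟩ => ⟨_, ⟨a.unop, h, rfl⟩, h'⟩⟩] at this
  exact this

variable {R}

/-- Since `j` is injective, denominators can be computed inside `B`. The case `B = S` gives `S'`,
and a subring inclusion gives the successor step of the sequence. -/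
theorem derived_range {B : Type*} [Ring B] {j : B →+* S} (hj : Function.Injective j)
    {f : R →+* B} (hf : j.comp f = R.subtype) :
    derived R (Set.range j) = j '' symDenomSubring f := by
  have hf' (r : R) : j (f r) = r := DFunLike.congr_fun hf r
  have hm (b : B) : j b ∈ R ↔ b ∈ f.range :=
    ⟨fun h => ⟨⟨_, h⟩, hj (hf' _)⟩, by rintro ⟨r, rfl⟩; rw [hf']; exact r.2⟩
  have hl (s : B) : leftColon R (j s) = j '' (f '' (denomIdeal f s : Set R)) := by
    ext a
    constructor
    · rintro ⟨ha, h⟩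
      refine ⟨f ⟨a, ha⟩, ⟨⟨a, ha⟩, ?_, rfl⟩, hf' _⟩
      rw [SetLike.mem_coe, mem_denomIdeal, ← hm, map_mul, hf']; exact h
    · rintro ⟨_, ⟨a, ha, rfl⟩, rfl⟩
      refine ⟨(hf' a).symm ▸ a.2, ?_⟩
      rw [← map_mul, hm]; exact ha
  have hr (s : B) : rightColon R (j s) = j '' {b | ∃ a : R, s * f a ∈ f.range ∧ f a = b} := by
    ext a
    constructor
    · rintro ⟨ha, h⟩
      refine ⟨f ⟨a, ha⟩, ⟨⟨a, ha⟩, ?_, rfl⟩, hf' _⟩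
      rw [← hm, map_mul, hf']; exact h
    · rintro ⟨_, ⟨a, ha, rfl⟩, rfl⟩
      refine ⟨(hf' a).symm ▸ a.2, ?_⟩
      rw [← map_mul, hm]; exact ha
  have hr' (s : B) : MulOpposite.op '' {b | ∃ a : R, s * f a ∈ f.range ∧ f a = b} =
      RingHom.op f '' (denomIdeal (RingHom.op f) (MulOpposite.op s) : Set _) := by
    ext x
    constructor
    · rintro ⟨_, ⟨a, h, rfl⟩, rfl⟩
      exact ⟨MulOpposite.op a, mem_denomIdeal_op.2 h, rfl⟩
    · rintro ⟨a, h, rfl⟩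
      exact ⟨_, ⟨a.unop, mem_denomIdeal_op.1 h, rfl⟩, rfl⟩
  have key (s : B) (r : R) : ((mulSpan (Set.range j) (leftColon R (r * j s)) : Set S) =
      Set.range j ∧ (mulSpan (rightColon R (j s * r)) (Set.range j) : Set S) = Set.range j) ↔
      ((colon (denomIdeal f s) r).map f = ⊤ ∧ (colon (denomIdeal (RingHom.op f)
        (MulOpposite.op s)) (MulOpposite.op r)).map (RingHom.op f) = ⊤) := by
    rw [← hf', ← map_mul, ← map_mul, hl, hr, mulSpan_range_left_eq_iff hj,
      mulSpan_range_right_eq_iff hj, hr', colon_denomIdeal, colon_denomIdeal]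
    rfl
  ext x
  constructor
  · rintro ⟨⟨s, rfl⟩, h⟩
    exact ⟨s, ⟨fun r => ((key s r).1 (h r r.2)).1,
      fun r => ((key s r.unop).1 (h _ r.unop.2)).2⟩, rfl⟩
  · rintro ⟨s, hs, rfl⟩
    exact ⟨⟨s, rfl⟩, fun r hr => (key s ⟨r, hr⟩).2 ⟨hs.1 _, hs.2 _⟩⟩

theorem derived_univ (R : Subring S) :
    derived R Set.univ = (symDenomSubring R.subtype : Set S) := by
  have := derived_range (R := R) (j := RingHom.id S) (f := R.subtype) Function.injective_id rfl
  rwa [show Set.range (RingHom.id S) = Set.univ from Set.range_id,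
    show RingHom.id S '' _ = _ from Set.image_id _] at this

theorem exists_subring_eq_derived {T : Subring S} (hT : R ≤ T) :
    ∃ T' : Subring S, R ≤ T' ∧ (T' : Set S) = derived R (T : Set S) := by
  refine ⟨(symDenomSubring (Subring.inclusion hT)).map T.subtype, fun r hr => ?_, ?_⟩
  · exact ⟨_, range_le_symDenomSubring _ ⟨⟨r, hr⟩, rfl⟩, rfl⟩
  · rw [Subring.coe_map, ← derived_range (R := R) Subtype.val_injective rfl]
    exact congrArg (derived R) (Subtype.range_val (s := (T : Set S)))

/-! ### The transfinite sequence -/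

theorem derived_subset (R : Subring S) (T : Set S) : derived R T ⊆ T := fun _ h => h.1

theorem derivedSeq_zero (R : Subring S) : derivedSeq R 0 = Set.univ :=
  Ordinal.limitRecOn_zero ..

theorem derivedSeq_add_one (R : Subring S) (α : Ordinal.{u}) :
    derivedSeq R (α + 1) = derived R (derivedSeq R α) :=
  Ordinal.limitRecOn_add_one ..

theorem derivedSeq_limit (R : Subring S) {α : Ordinal.{u}} (h : Order.IsSuccLimit α) :
    derivedSeq R α = {s | ∀ β < α, s ∈ derivedSeq R β} :=
  Ordinal.limitRecOn_limit _ _ _ _ h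

theorem exists_subring_eq_derivedSeq (R : Subring S) (α : Ordinal.{u}) :
    ∃ T : Subring S, R ≤ T ∧ (T : Set S) = derivedSeq R α := by
  induction α using Ordinal.limitRecOn with
  | zero => exact ⟨⊤, le_top, (derivedSeq_zero R).symm⟩
  | add_one α ih =>
    obtain ⟨T, hT, h⟩ := ih
    rw [derivedSeq_add_one, ← h]
    exact exists_subring_eq_derived hT
  | limit α hα ih =>
    choose T hT h using ih
    refine ⟨⨅ β : Set.Iio α, T β.1 β.2, le_iInf fun β => hT _ _, ?_⟩
    rw [derivedSeq_limit R hα, Subring.coe_iInf]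
    ext s
    simp only [Set.mem_iInter, Subtype.forall, Set.mem_Iio, Set.mem_ofPred_eq]
    exact forall₂_congr fun β hβ => by rw [h β hβ]

theorem derivedSeq_antitone (R : Subring S) : Antitone (derivedSeq R) := by
  intro α β h
  induction β using Ordinal.limitRecOn with
  | zero => rw [nonpos_iff_eq_zero.1 h]
  | add_one β ih =>
    rcases h.eq_or_lt with rfl | h
    · rfl
    · rw [derivedSeq_add_one]
      exact (derived_subset R _).trans (ih (Order.lt_add_one_iff.1 h))
  | limit β hβ ih =>
    rcases h.eq_or_lt with rfl | h
    · rfl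
    · rw [derivedSeq_limit R hβ]
      exact fun s hs => hs α h

/-- The ordinals of the universe of `S` do not inject into the subsets of `S`, so some value
repeats. In a decreasing sequence a repetition forces two consecutive terms to agree, and from there
the sequence is constant. -/
theorem exists_derivedSeq_stable (R : Subring S) :
    ∃ γ : Ordinal.{u}, derivedSeq R γ = derivedSeq R (γ + 1) ∧
      ∀ α, γ ≤ α → derivedSeq R α = derivedSeq R γ := by
  obtain ⟨γ, hγ⟩ : ∃ γ : Ordinal.{u}, derivedSeq R γ = derivedSeq R (γ + 1) := by
    by_contra! hne
    have hlt {α β : Ordinal.{u}} (h : α < β) : derivedSeq R α ≠ derivedSeq R β := fun e =>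
      hne α <| (e.le.trans (derivedSeq_antitone R (Order.add_one_le_of_lt h))).antisymm
        (derivedSeq_antitone R (Order.le_succ α))
    refine not_injective_of_ordinal (derivedSeq R) fun α β h => ?_
    rcases lt_trichotomy α β with h' | h' | h'
    exacts [(hlt h' h).elim, h', (hlt h' h.symm).elim]
  refine ⟨γ, hγ, fun α h => ?_⟩
  refine (derivedSeq_antitone R h).antisymm ?_
  induction α using Ordinal.limitRecOn with
  | zero => rw [nonpos_iff_eq_zero.1 h]
  | add_one α ih =>
    rcases h.eq_or_lt with rfl | h
    · rfl
    · have h' := Order.lt_add_one_iff.1 h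
      rw [derivedSeq_add_one, (derivedSeq_antitone R h').antisymm (ih h'), ← derivedSeq_add_one]
      exact hγ.le
  | limit α hα ih =>
    rw [derivedSeq_limit R hα]
    intro s hs β hβ
    rcases le_total γ β with h' | h'
    · exact ih β hβ h' hs
    · exact derivedSeq_antitone R h' hs

end Derived

/-! ### Balanced tensor products -/

section Balanced

variable {R : Type*} [Ring R] {N M : Type*} [AddCommGroup N] [Module Rᵐᵒᵖ N] [AddCommGroup M]
  [Module R M]

/-- `n ⊗ m`. -/
def BalTensor.tmul (R : Type*) [Ring R] {N M : Type*} [AddCommGroup N] [Module Rᵐᵒᵖ N]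
    [AddCommGroup M] [Module R M] : N →+ M →+ BalTensor R N M :=
  AddMonoidHom.mk' (fun n => AddMonoidHom.mk'
    (fun m => QuotientAddGroup.mk' (balancedRel R N M) (n ⊗ₜ m))
    (fun m m' => by rw [TensorProduct.tmul_add, map_add]))
    (fun n n' => by ext m; simp [TensorProduct.add_tmul])

theorem BalTensor.smul_tmul (n : N) (r : R) (m : M) :
    BalTensor.tmul R (MulOpposite.op r • n) m = BalTensor.tmul R n (r • m) :=
  (QuotientAddGroup.eq_iff_sub_mem (N := balancedRel R N M)).2
    (AddSubgroup.subset_closure ⟨n, r, m, rfl⟩)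

theorem BalTensor.induction_on {p : BalTensor R N M → Prop} (x : BalTensor R N M)
    (tmul : ∀ n m, p (BalTensor.tmul R n m)) (add : ∀ x y, p x → p y → p (x + y)) : p x := by
  obtain ⟨x, rfl⟩ := QuotientAddGroup.mk'_surjective _ x
  induction x with
  | zero => simpa using tmul 0 0
  | tmul n m => exact tmul n m
  | add x y hx hy => rw [map_add]; exact add _ _ hx hy

theorem BalTensor.hom_ext {P : Type*} [AddCommGroup P] {φ ψ : BalTensor R N M →+ P}
    (h : ∀ n m, φ (BalTensor.tmul R n m) = ψ (BalTensor.tmul R n m)) : φ = ψ := by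
  refine DFunLike.ext _ _ fun x => ?_
  induction x using BalTensor.induction_on with
  | tmul n m => exact h n m
  | add x y hx hy => rw [map_add, map_add, hx, hy]

/-- The universal property. -/
def BalTensor.lift {P : Type*} [AddCommGroup P] (φ : N →+ M →+ P)
    (h : ∀ n (r : R) m, φ (MulOpposite.op r • n) m = φ n (r • m)) : BalTensor R N M →+ P :=
  QuotientAddGroup.lift _ (TensorProduct.liftAddHom φ fun z n m => by simp) (by
    rw [balancedRel, AddSubgroup.closure_le]
    rintro _ ⟨n, r, m, rfl⟩
    simp [h])

@[simp]
theorem BalTensor.map_tmul {N' M' : Type*} [AddCommGroup N'] [Module Rᵐᵒᵖ N'] [AddCommGroup M']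
    [Module R M'] (g : N →ₗ[Rᵐᵒᵖ] N') (h : M →ₗ[R] M') (n : N) (m : M) :
    BalTensor.map R g h (BalTensor.tmul R n m) = BalTensor.tmul R (g n) (h m) := rfl

end Balanced

/-! ### Extension of scalars -/

section BaseChange

variable {A B : Type u} [Ring A] [Ring B]

/-- `B ⊗_A M`, for a ring homomorphism `f : A → B`. -/
def BaseChange (f : A →+* B) (M : Type u) [AddCommGroup M] [Module A M] : Type u :=
  letI := rightMod f
  BalTensor A B M

variable (f : A →+* B) {M M' : Type u} [AddCommGroup M] [Module A M] [AddCommGroup M'] [Module A M']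

instance BaseChange.addCommGroup : AddCommGroup (BaseChange f M) :=
  letI := rightMod f
  QuotientAddGroup.Quotient.addCommGroup (balancedRel A B M)

/-- `b ⊗ m`. -/
def BaseChange.tmul : B →+ M →+ BaseChange f M :=
  letI := rightMod f
  BalTensor.tmul A

variable {f}

theorem BaseChange.mul_tmul (b : B) (a : A) (m : M) :
    BaseChange.tmul f (b * f a) m = BaseChange.tmul f b (a • m) :=
  letI := rightMod f
  BalTensor.smul_tmul b a m

theorem BaseChange.tmul_eq_one_tmul (a : A) (m : M) :
    BaseChange.tmul f (f a) m = BaseChange.tmul f 1 (a • m) := by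
  rw [← mul_tmul, one_mul]

theorem BaseChange.induction_on {p : BaseChange f M → Prop} (x : BaseChange f M)
    (tmul : ∀ b m, p (BaseChange.tmul f b m)) (add : ∀ x y, p x → p y → p (x + y)) : p x :=
  letI := rightMod f
  BalTensor.induction_on x tmul add

theorem BaseChange.hom_ext {P : Type*} [AddCommGroup P] {φ ψ : BaseChange f M →+ P}
    (h : ∀ b m, φ (BaseChange.tmul f b m) = ψ (BaseChange.tmul f b m)) : φ = ψ :=
  letI := rightMod f
  BalTensor.hom_ext h

/-- The universal property. -/
def BaseChange.lift {P : Type*} [AddCommGroup P] (φ : B →+ M →+ P)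
    (h : ∀ b a m, φ (b * f a) m = φ b (a • m)) : BaseChange f M →+ P :=
  letI := rightMod f
  BalTensor.lift φ h

@[simp]
theorem BaseChange.lift_tmul {P : Type*} [AddCommGroup P] (φ : B →+ M →+ P)
    (h : ∀ b a m, φ (b * f a) m = φ b (a • m)) (b : B) (m : M) :
    BaseChange.lift φ h (BaseChange.tmul f b m) = φ b m := rfl

variable (f) in
/-- `B ⊗_A h`. -/
def BaseChange.map (h : M →ₗ[A] M') : BaseChange f M →+ BaseChange f M' :=
  letI := rightMod f
  BalTensor.map A LinearMap.id h

@[simp]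
theorem BaseChange.map_tmul (h : M →ₗ[A] M') (b : B) (m : M) :
    BaseChange.map f h (BaseChange.tmul f b m) = BaseChange.tmul f b (h m) := rfl

theorem isRightFlat_iff : IsRightFlat f ↔ ∀ (M M' : Type u) [AddCommGroup M] [AddCommGroup M']
    [Module A M] [Module A M'] (h : M →ₗ[A] M'), Function.Injective h →
      Function.Injective (BaseChange.map f h) := Iff.rfl

variable (f M) in
/-- The action of an element of `B` on `B ⊗_A M`. -/
def BaseChange.mulHom (b : B) : BaseChange f M →+ BaseChange f M :=
  BaseChange.lift ((BaseChange.tmul f).comp (AddMonoidHom.mulLeft b)) fun b' a m =>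
    (congrArg (fun c => BaseChange.tmul f c m) (mul_assoc b b' (f a)).symm).trans
      (mul_tmul (b * b') a m)

theorem BaseChange.mulHom_tmul (b b' : B) (m : M) :
    BaseChange.mulHom f M b (BaseChange.tmul f b' m) = BaseChange.tmul f (b * b') m := rfl

variable (f M) in
/-- The action of `B` on `B ⊗_A M`. -/
def BaseChange.action : B →+* AddMonoid.End (BaseChange f M) where
  toFun := BaseChange.mulHom f M
  map_one' := hom_ext fun b m => by rw [mulHom_tmul, one_mul]; rfl
  map_mul' b b' := hom_ext fun c m => by rw [mulHom_tmul, mul_assoc]; rfl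
  map_zero' := hom_ext fun b m => by rw [mulHom_tmul, zero_mul, map_zero]; rfl
  map_add' b b' := hom_ext fun c m => by rw [mulHom_tmul, add_mul, map_add]; rfl

instance : Module B (BaseChange f M) := Module.compHom _ (BaseChange.action f M)

@[simp]
theorem BaseChange.smul_tmul (b b' : B) (m : M) :
    b • BaseChange.tmul f b' m = BaseChange.tmul f (b * b') m := rfl

theorem BaseChange.smul_one_tmul (b : B) (m : M) :
    b • BaseChange.tmul f 1 m = BaseChange.tmul f b m := by
  rw [smul_tmul, mul_one]

/-! ### Flatness and annihilators -/

theorem exists_quotient_lift {I : Ideal A} {P : Type*} [AddCommGroup P] (g : A →+ P)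
    (h : ∀ a ∈ I, g a = 0) : ∃ g' : A ⧸ I →+ P, ∀ a, g' (I.mkQ a) = g a :=
  ⟨QuotientAddGroup.lift I.toAddSubgroup g h, fun _ => rfl⟩

/-- The map `B ⊗_A A/I → B / B f(I)`, `b ⊗ a ↦ b f(a)`, sends `1 ⊗ 1` to the class of `1`. -/
theorem map_eq_top_of_one_tmul_eq_zero {I : Ideal A}
    (h : BaseChange.tmul f (1 : B) (I.mkQ 1) = 0) : I.map f = ⊤ := by
  let g : A →+ B →+ B ⧸ I.map f :=
    ((AddMonoidHom.compHom ((I.map f).mkQ.toAddMonoidHom)).comp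
      (AddMonoidHom.mul (R := B)).flip).comp f.toAddMonoidHom
  have hg (a : A) (b : B) : g a b = (I.map f).mkQ (b * f a) := rfl
  obtain ⟨g', hg'⟩ := exists_quotient_lift (I := I) g fun a ha => by
    ext b
    rw [hg, AddMonoidHom.zero_apply, Submodule.mkQ_apply, Submodule.Quotient.mk_eq_zero]
    exact Ideal.mul_mem_left _ _ (Ideal.mem_map_of_mem f ha)
  have h' := congrArg (BaseChange.lift g'.flip fun b a m => by
    obtain ⟨c, rfl⟩ := I.mkQ_surjective m
    rw [← map_smul, AddMonoidHom.flip_apply, AddMonoidHom.flip_apply, hg', hg', hg, hg,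
      smul_eq_mul, f.map_mul, mul_assoc]) h
  rw [BaseChange.lift_tmul, AddMonoidHom.flip_apply, hg', hg, map_zero, map_one, mul_one,
    Submodule.mkQ_apply, Submodule.Quotient.mk_eq_zero] at h'
  exact (Ideal.eq_top_iff_one _).2 h'

theorem subsingleton_baseChange_quotient_iff {I : Ideal A} :
    Subsingleton (BaseChange f (A ⧸ I)) ↔ I.map f = ⊤ := by
  refine ⟨fun h => map_eq_top_of_one_tmul_eq_zero (Subsingleton.elim _ _), fun h => ?_⟩
  refine subsingleton_of_forall_eq 0 fun x => ?_
  induction x using BaseChange.induction_on with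
  | tmul b m =>
    obtain ⟨a, rfl⟩ := I.mkQ_surjective m
    have : I.mkQ a = a • I.mkQ 1 := by rw [← map_smul, smul_eq_mul, mul_one]
    rw [this, ← BaseChange.mul_tmul, ← BaseChange.smul_one_tmul]
    suffices BaseChange.tmul f (1 : B) (I.mkQ 1) = 0 by rw [this, smul_zero]
    refine eq_zero_of_map_eq_top h fun i hi => ?_
    rw [BaseChange.smul_one_tmul, BaseChange.tmul_eq_one_tmul, ← map_smul, smul_eq_mul, mul_one,
      (Submodule.Quotient.mk_eq_zero I (x := i)).2 hi |> fun h => (h : I.mkQ i = 0), map_zero]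
  | add x y hx hy => rw [hx, hy, add_zero]

theorem mem_leftTensorFilter {I : Ideal A} : I ∈ leftTensorFilter f ↔ I.map f = ⊤ :=
  subsingleton_baseChange_quotient_iff

/-- `A / ann(m)` embeds into `M` with `1 ↦ m`, so flatness pulls `1 ⊗ m = 0` back to `1 ⊗ 1 = 0` in
`B ⊗_A A / ann(m)`. -/
theorem IsRightFlat.map_ker_eq_top (hf : IsRightFlat f) {m : M}
    (h : BaseChange.tmul f (1 : B) m = 0) :
    Ideal.map f (LinearMap.ker (LinearMap.toSpanSingleton A M m)) = ⊤ := by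
  refine map_eq_top_of_one_tmul_eq_zero (isRightFlat_iff.1 hf _ _
    ((LinearMap.ker (LinearMap.toSpanSingleton A M m)).liftQ (LinearMap.toSpanSingleton A M m) le_rfl)
    (LinearMap.ker_eq_bot.1 (Submodule.ker_liftQ_eq_bot _ _ _ le_rfl)) ?_)
  rw [map_zero, BaseChange.map_tmul, Submodule.mkQ_apply, Submodule.liftQ_apply,
    LinearMap.toSpanSingleton_apply, one_smul, h]

/-- The annihilator of the class of `r` in `A / I` is `(I : r)`, so under flatness the condition for
`r = 1` implies it for all `r`. -/
theorem IsRightFlat.leftTensorFilter_eq (hf : IsRightFlat f) :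
    leftTensorFilter f = denomFilter f := by
  ext I
  rw [mem_leftTensorFilter]
  refine ⟨fun h r => ?_, map_eq_top_of_mem_denomFilter⟩
  have h0 : BaseChange.tmul f (1 : B) (I.mkQ r) = 0 :=
    (subsingleton_baseChange_quotient_iff.2 h).elim _ _
  refine map_eq_top_mono (fun a ha => ?_) (hf.map_ker_eq_top h0)
  rwa [LinearMap.mem_ker, LinearMap.toSpanSingleton_apply, ← map_smul, Submodule.mkQ_apply,
    Submodule.Quotient.mk_eq_zero] at ha

/-! ### The dominion -/

variable (f) in
/-- `b ⊗ c` in `B ⊗_A B`. -/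
def selfTmul : letI := leftMod f; B →+ B →+ BaseChange f B :=
  letI := leftMod f
  BaseChange.tmul f

/-- `s ⊗ 1 = 1 ⊗ s` in `B ⊗_A B`. -/
def InDominion (f : A →+* B) (s : B) : Prop :=
  selfTmul f s 1 = selfTmul f 1 s

theorem InDominion.map_mul {s : B} (h : InDominion f s) (a : A) : InDominion f (f a * s) := by
  let := leftMod f
  have h1 : f a • BaseChange.tmul f s (1 : B) = f a • BaseChange.tmul f (1 : B) s := congrArg _ h
  rw [BaseChange.smul_tmul, BaseChange.smul_one_tmul, BaseChange.tmul_eq_one_tmul] at h1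
  exact h1

/-- Applying `B ⊗_A (B → B / f(A))` to `s ⊗ 1 = 1 ⊗ s` gives `1 ⊗ s̄ = 0`, and the annihilator of
`s̄` is `denomIdeal f s`. -/
theorem IsRightFlat.map_denomIdeal_eq_top (hf : IsRightFlat f) {s : B} (h : InDominion f s) :
    (denomIdeal f s).map f = ⊤ := by
  let := leftMod f
  let P : Submodule A B :=
    { carrier := f.range
      add_mem' := fun h h' => add_mem h h'
      zero_mem' := zero_mem f.range
      smul_mem' := fun a b hb => mul_mem (RingHom.mem_range_self f a) hb }
  have h1 : BaseChange.tmul f (1 : B) (P.mkQ s) = 0 := by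
    have : BaseChange.map f P.mkQ (BaseChange.tmul f s (1 : B)) =
      BaseChange.map f P.mkQ (BaseChange.tmul f (1 : B) s) := congrArg _ h
    rw [BaseChange.map_tmul, BaseChange.map_tmul] at this
    rw [← this, show P.mkQ 1 = 0 from (Submodule.Quotient.mk_eq_zero P).2 (one_mem f.range),
      map_zero]
  refine map_eq_top_mono (fun a ha => ?_) (hf.map_ker_eq_top h1)
  rw [LinearMap.mem_ker, LinearMap.toSpanSingleton_apply, ← map_smul, Submodule.mkQ_apply,
    Submodule.Quotient.mk_eq_zero] at ha
  exact ha

theorem IsRightFlat.mem_denomSubring (hf : IsRightFlat f) {s : B} (h : InDominion f s) :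
    s ∈ denomSubring f := fun a => by
  rw [colon_denomIdeal]
  exact hf.map_denomIdeal_eq_top (h.map_mul a)

end BaseChange

section Epi

variable {A B : Type u} [Ring A] [Ring B] {f : A →+* B}

/-! ### Epimorphisms -/

/-- Restriction of scalars along a ring epimorphism is full. -/
theorem IsRingEpi.map_smul (hf : IsRingEpi f) {N N' : Type u} [AddCommGroup N] [AddCommGroup N']
    [Module B N] [Module B N'] (p : N →+ N') (hp : ∀ (a : A) (n : N), p (f a • n) = f a • p n)
    (b : B) (n : N) : p (b • n) = b • p n := by
  let g : B →+* AddMonoid.End (N × N') := Module.toAddMonoidEnd B (N × N')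
  -- Conjugating the action `g` on `N × N'` by `(n, n') ↦ (n, n' + p n)` changes nothing on `f(A)`,
  -- because `p` is `A`-linear. By the epimorphism property it changes nothing on `B`; evaluating at
  -- `(n, 0)` gives the claim.
  let v : AddMonoid.End (N × N') := AddMonoidHom.prod (AddMonoidHom.fst N N')
    (AddMonoidHom.snd N N' + p.comp (AddMonoidHom.fst N N'))
  let w : AddMonoid.End (N × N') := AddMonoidHom.prod (AddMonoidHom.fst N N')
    (AddMonoidHom.snd N N' - p.comp (AddMonoidHom.fst N N'))
  have hwv : w * v = 1 := DFunLike.ext _ _ fun x => Prod.ext rfl (add_sub_cancel_right _ _)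
  have hvw : v * w = 1 := DFunLike.ext _ _ fun x => Prod.ext rfl (sub_add_cancel _ _)
  let h : B →+* AddMonoid.End (N × N') :=
    { toFun := fun b => v * g b * w
      map_one' := by rw [map_one, mul_one, hvw]
      map_mul' := fun b b' => by
        rw [map_mul, show v * g b * w * (v * g b' * w) = v * g b * (w * v) * (g b' * w) by
          simp only [mul_assoc], hwv]
        simp only [mul_assoc, mul_one]
      map_zero' := by rw [map_zero, mul_zero, zero_mul]
      map_add' := fun b b' => by rw [map_add, mul_add, add_mul] }
  have hgh : h = g := by
    refine hf _ _ _ (RingHom.ext fun a => ?_)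
    have : v * g (f a) = g (f a) * v := DFunLike.ext _ _ fun x => Prod.ext rfl <| by
      change f a • x.2 + p (f a • x.1) = f a • (x.2 + p x.1)
      rw [hp, smul_add]
    change v * g (f a) * w = g (f a)
    rw [this, mul_assoc, hvw, mul_one]
  have key : v * g b = g b * v := by
    nth_rw 2 [← hgh]
    change v * g b = v * g b * w * v
    rw [mul_assoc _ w v, hwv, mul_one]
  have : b • (0 : N') + p (b • n) = b • (0 + p n) :=
    congrArg Prod.snd (DFunLike.congr_fun key (n, 0))
  rwa [smul_zero, zero_add, zero_add] at this

/-- The `A`-linear map `n ↦ 1 ⊗ n` is `B`-linear by fullness; evaluate it at `s • 1`. -/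
theorem IsRingEpi.inDominion (hf : IsRingEpi f) (s : B) : InDominion f s := by
  let := leftMod f
  have := hf.map_smul (N := B) (N' := BaseChange f B) (BaseChange.tmul f 1)
    (fun a n => (BaseChange.tmul_eq_one_tmul a n).symm.trans (BaseChange.smul_one_tmul _ _).symm) s 1
  rw [smul_eq_mul, mul_one, BaseChange.smul_one_tmul] at this
  exact this.symm

/-- For a denominator `a` of `s` both `g` and `g'` take the same value at `f(a) s`, which lies in
`f(A)`. Hence `g(f a)` kills `g s - g' s`. -/
theorem isRingEpi_of_map_denomIdeal (h : ∀ s, (denomIdeal f s).map f = ⊤) : IsRingEpi f := by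
  intro T _ g g' hg
  have hg' (a : A) : g (f a) = g' (f a) := DFunLike.congr_fun hg a
  ext s
  let := Module.compHom T g
  refine sub_eq_zero.1 (eq_zero_of_map_eq_top (h s) fun a ⟨c, hc⟩ => ?_)
  change g (f a) * (g s - g' s) = 0
  rw [mul_sub, ← map_mul, hg' a, ← map_mul, ← hc, hg', sub_self]

/-! ### Flatness from denominators -/

/-- If all elements of `B` have denominators, the kernel of `M → B ⊗_A M` is the torsion
submodule. -/
theorem ann_mem_denomFilter (hinj : Function.Injective f) (h : ∀ s, denomIdeal f s ∈ denomFilter f)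
    {M : Type u} [AddCommGroup M] [Module A M] {m : M} (hm : BaseChange.tmul f (1 : B) m = 0) :
    LinearMap.ker (LinearMap.toSpanSingleton A M m) ∈ denomFilter f := by
  have hF := isGabriel_denomFilter f
  classical
  -- `(A → M) ⧸ Z` consists of germs of functions along the filter. The map `s ⊗ m ↦ [a ↦ (a s) m]`,
  -- with `a s` read in `A`, is well defined on `B ⊗_A M` and sends `1 ⊗ m` to the germ of `a ↦ a
  -- m`.
  let Z : AddSubgroup (A → M) :=
    { carrier := {φ | ∃ I ∈ denomFilter f, ∀ a ∈ I, φ a = 0}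
      zero_mem' := ⟨⊤, hF.top_mem, fun _ _ => rfl⟩
      add_mem' := fun ⟨I, hI, h⟩ ⟨J, hJ, h'⟩ => ⟨I ⊓ J, hF.inf_mem _ _ hI hJ, fun a ha => by
        rw [Pi.add_apply, h a ha.1, h' a ha.2, add_zero]⟩
      neg_mem' := fun ⟨I, hI, h⟩ => ⟨I, hI, fun a ha => by rw [Pi.neg_apply, h a ha, neg_zero]⟩ }
  -- `ρ s a` is the element of `A` with image `f a * s`; its arbitrary values off `denomIdeal f s`
  -- do not affect the germ.
  choose! ρ hρ using fun (s : B) (a : A) (ha : a ∈ denomIdeal f s) => ha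
  have hZ {φ ψ : A → M} {I : Ideal A} (hI : I ∈ denomFilter f) (e : ∀ a ∈ I, φ a = ψ a) :
      QuotientAddGroup.mk' Z φ = QuotientAddGroup.mk' Z ψ :=
    QuotientAddGroup.eq_iff_sub_mem.2 ⟨I, hI, fun a ha => sub_eq_zero.2 (e a ha)⟩
  let Φ : B →+ M →+ (A → M) ⧸ Z := AddMonoidHom.mk' (fun s => AddMonoidHom.mk'
    (fun m => QuotientAddGroup.mk' Z fun a => ρ s a • m) fun m m' => by
      rw [← map_add]; exact congrArg _ (funext fun a => smul_add _ _ _)) fun s t => by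
    ext m
    refine hZ (ψ := (fun a => ρ s a • m) + fun a => ρ t a • m)
      (hF.inf_mem _ _ (hF.inf_mem _ _ (h s) (h t)) (h (s + t))) fun a ha => ?_
    rw [Pi.add_apply, ← add_smul]
    refine congrArg (· • m) (hinj ?_)
    rw [map_add, hρ _ _ ha.1.1, hρ _ _ ha.1.2, hρ _ _ ha.2, mul_add]
  have hΦ (s : B) (m : M) : Φ s m = QuotientAddGroup.mk' Z fun a => ρ s a • m := rfl
  have key := congrArg (BaseChange.lift Φ fun b a m => by
    rw [hΦ, hΦ]
    refine hZ (hF.inf_mem _ _ (h b) (h (b * f a))) fun c hc => ?_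
    rw [smul_smul]
    refine congrArg (· • m) (hinj ?_)
    rw [map_mul, hρ _ _ hc.1, hρ _ _ hc.2, mul_assoc]) hm
  rw [BaseChange.lift_tmul, map_zero, hΦ, QuotientAddGroup.mk'_apply,
    QuotientAddGroup.eq_zero_iff] at key
  obtain ⟨I, hI, hI'⟩ := key
  refine hF.mem_of_le _ _ (hF.inf_mem _ _ hI (h 1)) fun a ha => ?_
  have h1 : ρ 1 a = a := hinj (by rw [hρ _ _ ha.2, mul_one])
  have h2 : ρ 1 a • m = 0 := hI' a ha.1
  rwa [h1] at h2

/-- An ideal in the filter carries `x` in the kernel to elements `1 ⊗ m` with `1 ⊗ g m = 0`. Then `g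
m`, and so `m`, is torsion, hence `1 ⊗ m = 0`, and cancellation gives `x = 0`. -/
theorem isRightFlat_of_denomIdeal (hinj : Function.Injective f)
    (h : ∀ s, denomIdeal f s ∈ denomFilter f) : IsRightFlat f := by
  rw [isRightFlat_iff]
  intro M M' _ _ _ _ g hg
  have hF := isGabriel_denomFilter f
  refine (injective_iff_map_eq_zero _).2 fun x hx => ?_
  obtain ⟨I, hI, hxI⟩ : ∃ I ∈ denomFilter f, ∀ i ∈ I, ∃ m, f i • x = BaseChange.tmul f 1 m := by
    clear hx
    induction x using BaseChange.induction_on with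
    | tmul b m =>
      refine ⟨_, h b, fun i ⟨c, hc⟩ => ⟨c • m, ?_⟩⟩
      rw [BaseChange.smul_tmul, ← hc, BaseChange.tmul_eq_one_tmul]
    | add x y hx hy =>
      obtain ⟨I, hI, h⟩ := hx
      obtain ⟨J, hJ, h'⟩ := hy
      refine ⟨I ⊓ J, hF.inf_mem _ _ hI hJ, fun i hi => ?_⟩
      obtain ⟨m, hm⟩ := h i hi.1
      obtain ⟨m', hm'⟩ := h' i hi.2
      exact ⟨m + m', by rw [smul_add, hm, hm', map_add]⟩
  have hmap (b : B) (y : BaseChange f M) :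
      BaseChange.map f g (b • y) = b • BaseChange.map f g y := by
    induction y using BaseChange.induction_on with
    | tmul c m => rfl
    | add y z hy hz => rw [smul_add, map_add, map_add, smul_add, hy, hz]
  refine eq_zero_of_map_eq_top (map_eq_top_of_mem_denomFilter hI) fun i hi => ?_
  obtain ⟨m, hm⟩ := hxI i hi
  rw [hm]
  have h0 : BaseChange.tmul f (1 : B) (g m) = 0 := by
    rw [← BaseChange.map_tmul, ← hm, hmap, hx, smul_zero]
  refine eq_zero_of_map_eq_top
    (map_eq_top_of_mem_denomFilter (ann_mem_denomFilter hinj h h0)) fun a ha => ?_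
  rw [LinearMap.mem_ker, LinearMap.toSpanSingleton_apply, ← _root_.map_smul] at ha
  rw [BaseChange.smul_one_tmul, BaseChange.tmul_eq_one_tmul, hg (ha.trans (map_zero g).symm),
    map_zero]

/-! ### Passage to opposite rings -/

/-- `N ⊗_A B` as `Bᵐᵒᵖ ⊗_{Aᵐᵒᵖ} N`. -/
theorem exists_swap (f : A →+* B) (N : Type u) [AddCommGroup N] [Module Aᵐᵒᵖ N] :
    letI := leftMod f
    ∃ e : BalTensor A N B ≃+ BaseChange (RingHom.op f) N, ∀ n b,
      e (BalTensor.tmul A n b) = BaseChange.tmul (RingHom.op f) (MulOpposite.op b) n := by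
  let := leftMod f
  let φ : BalTensor A N B →+ BaseChange (RingHom.op f) N := BalTensor.lift
    (((BaseChange.tmul (RingHom.op f)).comp
      (MulOpposite.opAddEquiv : B ≃+ Bᵐᵒᵖ).toAddMonoidHom).flip)
    fun n a b => (BaseChange.mul_tmul (f := RingHom.op f) (MulOpposite.op b) (MulOpposite.op a) n).symm
  let ψ : BaseChange (RingHom.op f) N →+ BalTensor A N B := BaseChange.lift
    ((BalTensor.tmul A (N := N) (M := B)).flip.comp
      (MulOpposite.opAddEquiv : B ≃+ Bᵐᵒᵖ).symm.toAddMonoidHom)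
    fun b a n => (BalTensor.smul_tmul n a.unop b.unop).symm
  refine ⟨AddMonoidHom.toAddEquiv φ ψ (BalTensor.hom_ext fun n b => rfl)
    (BaseChange.hom_ext fun b n => rfl), fun n b => rfl⟩

theorem isLeftFlat_iff_op : IsLeftFlat f ↔ IsRightFlat (RingHom.op f) := by
  rw [isRightFlat_iff]
  let := leftMod f
  refine forall₂_congr fun N N' => forall₄_congr fun _ _ _ _ => forall₂_congr fun g _ => ?_
  obtain ⟨e, he⟩ := exists_swap f N
  obtain ⟨e', he'⟩ := exists_swap f N'
  have key : (BaseChange.map (RingHom.op f) g).comp e.toAddMonoidHom =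
      e'.toAddMonoidHom.comp (BalTensor.map A g (LinearMap.id : B →ₗ[A] B)) :=
    BalTensor.hom_ext fun n b => by
      change BaseChange.map _ g (e _) = e' (BalTensor.map A g _ _)
      rw [he, BalTensor.map_tmul, he']; rfl
  rw [← e'.injective.of_comp_iff, ← EquivLike.injective_comp e (BaseChange.map _ g)]
  exact (congrArg Function.Injective (congrArg DFunLike.coe key.symm)).to_iff

theorem rightTensorFilter_eq : rightTensorFilter f = leftTensorFilter (RingHom.op f) := by
  let := leftMod f
  ext J
  obtain ⟨e, -⟩ := exists_swap f (Aᵐᵒᵖ ⧸ J)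
  exact e.toEquiv.subsingleton_congr

theorem InDominion.op {s : B} (h : InDominion f s) :
    InDominion (RingHom.op f) (MulOpposite.op s) := by
  let := leftMod f
  let := leftMod (RingHom.op f)
  let o : B →+ Bᵐᵒᵖ := (MulOpposite.opAddEquiv : B ≃+ Bᵐᵒᵖ).toAddMonoidHom
  let ψ : BaseChange f B →+ BaseChange (RingHom.op f) Bᵐᵒᵖ := BaseChange.lift
    ((AddMonoidHom.compHom' o).comp ((BaseChange.tmul (RingHom.op f) (M := Bᵐᵒᵖ)).flip.comp o))
    fun b a c => (BaseChange.mul_tmul (f := RingHom.op f) (MulOpposite.op c) (MulOpposite.op a)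
      (MulOpposite.op b)).symm
  exact (congrArg ψ h).symm

end Epi

/-! ### Enveloping rings -/

section Envelope

variable {R S : Type u} [Ring R] [Ring S] (f : R →+* S)

/-- The map between enveloping rings induced by `f`. -/
def envMap : Env R →+* Env S :=
  (Algebra.TensorProduct.map f.toIntAlgHom (RingHom.op f).toIntAlgHom).toRingHom

variable {f}

theorem envMap_tmul (a : R) (b : Rᵐᵒᵖ) :
    envMap f (a ⊗ₜ b) = f a ⊗ₜ (RingHom.op f b) := rfl

theorem envMap_smul (ε : Env R) (x : S) : envMap f ε • x = bimoduleAction f ε x := by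
  induction ε using Env.induction_on with
  | tmul a b => rw [envMap_tmul, env_tmul_smul, bimoduleAction_tmul]; rfl
  | add a b ha hb => rw [map_add, map_add, add_smul, ha, hb]; rfl

theorem tmul_mul_envMap_tmul (x : S) (y : S) (a : R) (b : Rᵐᵒᵖ) :
    (x ⊗ₜ MulOpposite.op y : Env S) * envMap f (a ⊗ₜ b) =
      (x * f a) ⊗ₜ MulOpposite.op (f b.unop * y) := by
  rw [envMap_tmul, Algebra.TensorProduct.tmul_mul_tmul]; rfl

theorem tmul_mul_envMap_inl (x : S) (y : S) (a : R) :
    (x ⊗ₜ MulOpposite.op y : Env S) * envMap f (inl a) = (x * f a) ⊗ₜ MulOpposite.op y := by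
  rw [inl, tmul_mul_envMap_tmul, MulOpposite.unop_one, map_one, one_mul]

theorem tmul_mul_envMap_inr (x : S) (y : S) (b : Rᵐᵒᵖ) :
    (x ⊗ₜ MulOpposite.op y : Env S) * envMap f (inr b) =
      x ⊗ₜ MulOpposite.op (f b.unop * y) := by
  rw [inr, tmul_mul_envMap_tmul, map_one, mul_one]

/-- Additive maps out of the enveloping ring. -/
def envLift {P : Type*} [AddCommGroup P] (φ : S →+ S →+ P) : Env S →+ P :=
  TensorProduct.liftAddHom
    ((AddMonoidHom.compHom' (MulOpposite.opAddEquiv : S ≃+ Sᵐᵒᵖ).symm.toAddMonoidHom).comp φ)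
    fun z x y => by
      simp only [AddMonoidHom.comp_apply, map_zsmul, AddMonoidHom.zsmul_apply]

@[simp]
theorem envLift_tmul {P : Type*} [AddCommGroup P] (φ : S →+ S →+ P) (x y : S) :
    envLift φ (x ⊗ₜ MulOpposite.op y) = φ x y := rfl

variable (f) in
/-- An element `s` that is carried into `R` by enough elements of the enveloping ring satisfies
`s ⊗ 1 = 1 ⊗ s` in `S ⊗_R S`. -/
theorem inDominion_of_map_envDenomIdeal {s : S}
    (h : (envDenomIdeal f s).map (envMap f) = ⊤) : InDominion f s := by
  let := leftMod f
  -- `ψ (x ⊗ y) = x s ⊗ y` and `ψ' (x ⊗ y) = x ⊗ s y`. On a multiple `(x ⊗ y) κ` they equal `x (κ s)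
  -- ⊗ y` and `x ⊗ (κ s) y`, which agree if `κ s ∈ f(R)`. Such `κ` generate the unit ideal, so `ψ 1
  -- = ψ' 1`.
  let ψ : Env S →+ BaseChange f S :=
    envLift ((BaseChange.tmul f).comp (AddMonoidHom.mulRight s))
  let ψ' : Env S →+ BaseChange f S :=
    envLift ((AddMonoidHom.compHom' (AddMonoidHom.mulLeft s)).comp (BaseChange.tmul f))
  have hbal (x y : S) (r : R) :
      BaseChange.tmul f (x * f r) y = BaseChange.tmul f x (f r * y) := BaseChange.mul_tmul x r y
  have h1 (x y : S) (κ : Env R) : ψ ((x ⊗ₜ MulOpposite.op y) * envMap f κ) =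
      BaseChange.tmul f (x * bimoduleAction f κ s) y := by
    induction κ using Env.induction_on with
    | tmul a b =>
      rw [tmul_mul_envMap_tmul, bimoduleAction_tmul, ← mul_assoc, hbal, ← mul_assoc]; rfl
    | add κ κ' h h' =>
      rw [map_add, mul_add, map_add, h, h', map_add, LinearMap.add_apply, mul_add, map_add]; rfl
  have h2 (x y : S) (κ : Env R) : ψ' ((x ⊗ₜ MulOpposite.op y) * envMap f κ) =
      BaseChange.tmul f x (bimoduleAction f κ s * y) := by
    induction κ using Env.induction_on with
    | tmul a b =>
      rw [tmul_mul_envMap_tmul, bimoduleAction_tmul, mul_assoc, mul_assoc, ← hbal]; rfl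
    | add κ κ' h h' =>
      rw [map_add, mul_add, map_add, h, h', map_add, LinearMap.add_apply, add_mul, map_add]
  let L : Ideal (Env S) :=
    { carrier := {η | ∀ ζ, ψ (ζ * η) = ψ' (ζ * η)}
      add_mem' := fun h h' ζ => by rw [mul_add, map_add, map_add, h ζ, h' ζ]
      zero_mem' := fun ζ => by rw [mul_zero, map_zero, map_zero]
      smul_mem' := fun ξ η h ζ => by rw [smul_eq_mul, ← mul_assoc]; exact h _ }
  have hL : (envDenomIdeal f s).map (envMap f) ≤ L := Ideal.span_le.2 <| by
    rintro _ ⟨κ, ⟨r, hr⟩, rfl⟩ ζ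
    induction ζ using Env.induction_on with
    | tmul x y =>
      rw [← MulOpposite.op_unop y, h1, h2, ← hr, hbal]
    | add ζ ξ h h' => rw [add_mul, map_add, map_add, h, h']
  rw [h] at hL
  have : ψ (1 * 1) = ψ' (1 * 1) := hL (Submodule.mem_top : (1 : Env S) ∈ (⊤ : Ideal (Env S))) 1
  rw [one_mul] at this
  have e1 : ψ 1 = BaseChange.tmul f (1 * s) 1 := rfl
  have e2 : ψ' 1 = BaseChange.tmul f 1 (s * 1) := rfl
  rw [e1, e2, one_mul, mul_one] at this
  exact this

theorem map_envMap_eq_top_of_comap {K : Ideal (Env R)}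
    (h : (K.comap (inlHom R)).map f = ⊤) : K.map (envMap f) = ⊤ := by
  have : (K.comap (inlHom R)).map f ≤ (K.map (envMap f)).comap (inlHom S) :=
    Ideal.span_le.2 <| by
      rintro _ ⟨a, ha, rfl⟩
      have e : inlHom S (f a) = envMap f (inlHom R a) := by
        change f a ⊗ₜ 1 = f a ⊗ₜ RingHom.op f 1
        rw [map_one]
      change inlHom S (f a) ∈ K.map (envMap f)
      rw [e]
      exact Ideal.mem_map_of_mem _ ha
  rw [h] at this
  rw [Ideal.eq_top_iff_one, ← map_one (inlHom S)]
  exact this Submodule.mem_top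

end Envelope

/-! ### Homomorphisms on ideals in the filter of a flat extension -/

section Lift

variable {A B : Type u} [Ring A] [Ring B] {f : A →+* B}

/-- The map `B ⊗ I → B ⊗ A` is injective by flatness, and `1 ⊗ 1` has a preimage `z` because `B f(I)
= B`. Take for `n` the image of `z` under `b ⊗ i ↦ b φ(i)`; injectivity gives `f(i) z = 1 ⊗ i`. -/
theorem IsRightFlat.exists_smul_eq (hf : IsRightFlat f) {I : Ideal A} (hI : I.map f = ⊤)
    {N : Type*} [AddCommGroup N] [Module B N] (φ : I →+ N)
    (hφ : ∀ (a : A) (i : I), φ (a • i) = f a • φ i) : ∃ n : N, ∀ i : I, f i • n = φ i := by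
  have hmap (b : B) (y : BaseChange f I) :
      BaseChange.map f I.subtype (b • y) = b • BaseChange.map f I.subtype y := by
    induction y using BaseChange.induction_on with
    | tmul c m => rfl
    | add y z hy hz => rw [smul_add, map_add, map_add, smul_add, hy, hz]
  obtain ⟨z, hz⟩ : ∃ z, BaseChange.map f I.subtype z = BaseChange.tmul f 1 (1 : A) := by
    suffices ∀ y ∈ I.map f, ∃ z, BaseChange.map f I.subtype z = BaseChange.tmul f y (1 : A) from
      this 1 (hI ▸ Submodule.mem_top)
    intro y hy
    induction hy using Submodule.span_induction with
    | mem x hx =>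
      obtain ⟨i, hi, rfl⟩ := hx
      refine ⟨BaseChange.tmul f 1 ⟨i, hi⟩, ?_⟩
      rw [BaseChange.map_tmul, BaseChange.tmul_eq_one_tmul, smul_eq_mul, mul_one]; rfl
    | zero => exact ⟨0, by rw [map_zero, map_zero, AddMonoidHom.zero_apply]⟩
    | add x y _ _ hx hy =>
      obtain ⟨z, hz⟩ := hx
      obtain ⟨w, hw⟩ := hy
      exact ⟨z + w, by rw [map_add, map_add, hz, hw, AddMonoidHom.add_apply]⟩
    | smul a x _ hx =>
      obtain ⟨z, hz⟩ := hx
      exact ⟨a • z, by rw [hmap, hz, BaseChange.smul_tmul, smul_eq_mul]⟩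
  let μ : BaseChange f I →+ N := BaseChange.lift
    ((AddMonoidHom.compHom' φ).comp (Module.toAddMonoidEnd B N).toAddMonoidHom) fun b a i => by
      change (b * f a) • φ i = b • φ (a • i)
      rw [hφ, mul_smul]
  have hμ (b : B) (y : BaseChange f I) : μ (b • y) = b • μ y := by
    induction y using BaseChange.induction_on with
    | tmul c i => exact mul_smul b c (φ i)
    | add y z hy hz => rw [smul_add, map_add, map_add, smul_add, hy, hz]
  refine ⟨μ z, fun i => ?_⟩
  have : f i • z = BaseChange.tmul f 1 i := by
    refine isRightFlat_iff.1 hf _ _ I.subtype Subtype.val_injective ?_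
    rw [hmap, hz, BaseChange.smul_one_tmul, BaseChange.map_tmul, BaseChange.tmul_eq_one_tmul,
      smul_eq_mul, mul_one]; rfl
  rw [← hμ, this]
  exact one_smul B (φ i)

end Lift

/-! ### Two-sided tensor products -/

section TwoSided

variable {R S : Type u} [Ring R] [Ring S] {f : R →+* S}
variable {M M' : Type u} [AddCommGroup M] [Module (Env R) M] [AddCommGroup M'] [Module (Env R) M']

theorem BaseChange.env_hom_ext {P : Type*} [AddCommGroup P]
    {φ ψ : BaseChange (envMap f) M →+ P}
    (h : ∀ x y m, φ (BaseChange.tmul (envMap f) (x ⊗ₜ MulOpposite.op y) m) =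
      ψ (BaseChange.tmul (envMap f) (x ⊗ₜ MulOpposite.op y) m)) : φ = ψ :=
  BaseChange.hom_ext fun η m => by
    induction η using Env.induction_on with
    | tmul x y => exact h x y.unop m
    | add η ζ h h' =>
      rw [map_add, AddMonoidHom.add_apply, map_add, map_add, h, h']

/-- Maps out of `S ⊗_R M ⊗_R S` in the form of a base change along the enveloping rings. -/
theorem BaseChange.exists_env_lift {P : Type*} [AddCommGroup P] (φ : S →+ S →+ M →+ P)
    (hl : ∀ x y a m, φ (x * f a) y m = φ x y (inl a • m))
    (hr : ∀ x y b m, φ x (f b * y) m = φ x y (inr (MulOpposite.op b) • m)) :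
    ∃ φ' : BaseChange (envMap f) M →+ P, ∀ x y m,
      φ' (BaseChange.tmul (envMap f) (x ⊗ₜ MulOpposite.op y) m) = φ x y m := by
  refine ⟨BaseChange.lift (envLift φ) fun η ε m => ?_, fun x y m => rfl⟩
  induction η using Env.induction_on with
  | tmul x y =>
    rw [← MulOpposite.op_unop y]
    induction ε using Env.induction_on generalizing m with
    | tmul a b =>
      have : (a ⊗ₜ b : Env R) = inr b * inl a := by simp [inl, inr]
      rw [tmul_mul_envMap_tmul, this, mul_smul, envLift_tmul, envLift_tmul, hl, hr]
      rfl
    | add ε ε' h h' =>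
      rw [map_add, mul_add, map_add, add_smul, map_add, ← h, ← h']; rfl
  | add η ζ h h' => rw [add_mul, map_add, map_add, AddMonoidHom.add_apply, h, h']; rfl

end TwoSided

section TwoSided

variable {R S : Type u} [Ring R] [Ring S] (f : R →+* S)
variable (M : Type u) {M' : Type u} [AddCommGroup M] [Module (Env R) M] [AddCommGroup M']
  [Module (Env R) M']

/-! ### Flatness of the enveloping ring -/

theorem inr_mul_inl (b : Rᵐᵒᵖ) (a : R) : inr b * inl a = inl a * inr b := by
  simp [inl, inr]

/-- A bimodule as a left module. -/
abbrev envLeft : Module R M := Module.compHom M (inlHom R)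

/-- `S ⊗_R M` for a bimodule `M`. -/
def LeftChange : Type u :=
  letI := envLeft (R := R) M
  BaseChange f M

instance : AddCommGroup (LeftChange f M) :=
  letI := envLeft (R := R) M
  BaseChange.addCommGroup f

variable {M}

/-- `x ⊗ m`. -/
def LeftChange.tmul : S →+ M →+ LeftChange f M :=
  letI := envLeft (R := R) M
  BaseChange.tmul f

variable {f}

theorem LeftChange.mul_tmul (x : S) (a : R) (m : M) :
    LeftChange.tmul f (x * f a) m = LeftChange.tmul f x (inl a • m) :=
  letI := envLeft (R := R) M
  BaseChange.mul_tmul x a m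

theorem LeftChange.induction_on {p : LeftChange f M → Prop} (x : LeftChange f M)
    (tmul : ∀ b m, p (LeftChange.tmul f b m)) (add : ∀ x y, p x → p y → p (x + y)) : p x :=
  letI := envLeft (R := R) M
  BaseChange.induction_on x tmul add

theorem LeftChange.hom_ext {P : Type*} [AddCommGroup P] {φ ψ : LeftChange f M →+ P}
    (h : ∀ b m, φ (LeftChange.tmul f b m) = ψ (LeftChange.tmul f b m)) : φ = ψ :=
  letI := envLeft (R := R) M
  BaseChange.hom_ext h

/-- The universal property. -/
def LeftChange.lift {P : Type*} [AddCommGroup P] (φ : S →+ M →+ P)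
    (h : ∀ x a m, φ (x * f a) m = φ x (inl a • m)) : LeftChange f M →+ P :=
  letI := envLeft (R := R) M
  BaseChange.lift φ h

variable (f) in
/-- `S ⊗_R h` for an additive map `h` that respects the left module structures. -/
def LeftChange.map (h : M →+ M') (hh : ∀ (a : R) m, h (inl a • m) = inl a • h m) :
    LeftChange f M →+ LeftChange f M' :=
  LeftChange.lift ((AddMonoidHom.compHom' h).comp (LeftChange.tmul f)) fun x a m =>
    (LeftChange.mul_tmul x a (h m)).trans (congrArg _ (hh a m).symm)

theorem LeftChange.map_injective (hf : IsRightFlat f) {h : M →+ M'}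
    (hh : ∀ (a : R) m, h (inl a • m) = inl a • h m) (hinj : Function.Injective h) :
    Function.Injective (LeftChange.map f h hh) := by
  let := envLeft (R := R) M
  let := envLeft (R := R) M'
  let h' : M →ₗ[R] M' := { h with map_smul' := hh }
  have : LeftChange.map f h hh = BaseChange.map f h' := LeftChange.hom_ext fun _ _ => rfl
  rw [this]
  exact isRightFlat_iff.1 hf M M' h' hinj

variable (f M) in
/-- The right action of an element of `R` on `S ⊗_R M`. -/
def LeftChange.rightMul (b : Rᵐᵒᵖ) : LeftChange f M →+ LeftChange f M :=
  LeftChange.map f (DistribSMul.toAddMonoidHom M (inr b)) fun a m => by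
    change inr b • inl a • m = inl a • inr b • m
    rw [← mul_smul, inr_mul_inl, mul_smul]

theorem LeftChange.rightMul_tmul (b : Rᵐᵒᵖ) (x : S) (m : M) :
    LeftChange.rightMul f M b (LeftChange.tmul f x m) = LeftChange.tmul f x (inrHom R b • m) := rfl

variable (f M) in
/-- The right action of `R` on `S ⊗_R M`. -/
def LeftChange.rightAction : Rᵐᵒᵖ →+* AddMonoid.End (LeftChange f M) where
  toFun := LeftChange.rightMul f M
  map_one' := hom_ext fun x m => by rw [rightMul_tmul, map_one, one_smul]; rfl
  map_mul' b b' := hom_ext fun x m => by rw [rightMul_tmul, map_mul, mul_smul]; rfl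
  map_zero' := hom_ext fun x m => by
    rw [rightMul_tmul, map_zero]
    exact (congrArg (LeftChange.tmul f x) (zero_smul (Env R) m)).trans (map_zero _)
  map_add' b b' := hom_ext fun x m => by rw [rightMul_tmul, map_add, add_smul, map_add]; rfl

instance : Module Rᵐᵒᵖ (LeftChange f M) := Module.compHom _ (LeftChange.rightAction f M)

theorem LeftChange.smul_tmul (b : Rᵐᵒᵖ) (x : S) (m : M) :
    b • LeftChange.tmul f x m = LeftChange.tmul f x (inr b • m) := rfl

theorem toAddMonoidHom_inl_smul (h : M →ₗ[Env R] M') (a : R) (m : M) :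
    h.toAddMonoidHom (inl a • m) = inl a • h.toAddMonoidHom m :=
  h.map_smul (inl a) m

variable (f) in
/-- `S ⊗_R h` as a homomorphism of right modules. -/
def LeftChange.mapLinear (h : M →ₗ[Env R] M') : LeftChange f M →ₗ[Rᵐᵒᵖ] LeftChange f M' where
  __ := LeftChange.map f h.toAddMonoidHom (toAddMonoidHom_inl_smul h)
  map_smul' b x := by
    change LeftChange.map f h.toAddMonoidHom _ (b • x) = b • LeftChange.map f h.toAddMonoidHom _ x
    induction x using LeftChange.induction_on with
    | tmul x m =>
      exact congrArg (LeftChange.tmul f x) (h.map_smul (inr b) m)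
    | add x y hx hy => rw [smul_add, map_add, map_add, smul_add, hx, hy]

variable (f M) in
/-- `(x ⊗ y) ⊗ m ↦ (x ⊗ m) ⊗ y` is injective. -/
theorem exists_iterated :
    letI := leftMod f
    ∃ Φ : BaseChange (envMap f) M →+ BalTensor R (LeftChange f M) S, Function.Injective Φ ∧
      ∀ x y m, Φ (BaseChange.tmul (envMap f) (x ⊗ₜ MulOpposite.op y) m) =
        BalTensor.tmul R (LeftChange.tmul f x m) y := by
  let := leftMod f
  obtain ⟨Φ, hΦ⟩ := BaseChange.exists_env_lift (f := f) (M := M)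
    (P := BalTensor R (LeftChange f M) S)
    (AddMonoidHom.mk' (fun x => ((BalTensor.tmul R).comp (LeftChange.tmul f x)).flip)
      fun x y => by ext; simp)
    (fun x y a m => congrArg (BalTensor.tmul R · y) (LeftChange.mul_tmul x a m))
    (fun x y b m => (BalTensor.smul_tmul (LeftChange.tmul f x m) b y).symm)
  let ι (x : S) : S →+ Env S := AddMonoidHom.mk' (fun y => x ⊗ₜ MulOpposite.op y)
    fun y y' => by rw [MulOpposite.op_add, TensorProduct.tmul_add]
  let κ : LeftChange f M →+ S →+ BaseChange (envMap f) M := LeftChange.lift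
    (AddMonoidHom.mk' (fun x => ((BaseChange.tmul (envMap f)).comp (ι x)).flip) fun x x' => by
      ext m y
      change BaseChange.tmul (envMap f) ((x + x') ⊗ₜ MulOpposite.op y) m =
        BaseChange.tmul (envMap f) (x ⊗ₜ MulOpposite.op y) m +
        BaseChange.tmul (envMap f) (x' ⊗ₜ MulOpposite.op y) m
      rw [TensorProduct.add_tmul, map_add]; rfl)
    fun x a m => by
      ext y
      change BaseChange.tmul (envMap f) ((x * f a) ⊗ₜ MulOpposite.op y) m =
        BaseChange.tmul (envMap f) (x ⊗ₜ MulOpposite.op y) (inl a • m)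
      rw [← BaseChange.mul_tmul, tmul_mul_envMap_inl]
  have hκ (x y : S) (m : M) : κ (LeftChange.tmul f x m) y =
    BaseChange.tmul (envMap f) (x ⊗ₜ MulOpposite.op y) m := rfl
  let Ψ : BalTensor R (LeftChange f M) S →+ BaseChange (envMap f) M := BalTensor.lift κ
    fun n b y => by
      induction n using LeftChange.induction_on with
      | tmul x m =>
        change _ = κ _ (f b * y)
        rw [LeftChange.smul_tmul, hκ, hκ, ← BaseChange.mul_tmul, tmul_mul_envMap_inr]
        rfl
      | add n n' h h' => rw [smul_add, map_add, map_add, AddMonoidHom.add_apply, h, h']; rfl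
  have hΨ : Ψ.comp Φ = AddMonoidHom.id _ := BaseChange.env_hom_ext fun x y m => by
    rw [AddMonoidHom.comp_apply, hΦ]; rfl
  exact ⟨Φ, Function.LeftInverse.injective (g := Ψ) (DFunLike.congr_fun hΨ), hΦ⟩

/-- The enveloping ring of a two-sided flat extension is flat. -/
theorem isRightFlat_envMap (hl : IsLeftFlat f) (hr : IsRightFlat f) : IsRightFlat (envMap f) := by
  rw [isRightFlat_iff]
  intro M M' _ _ _ _ h hinj
  let := leftMod f
  obtain ⟨Φ, hΦ, e⟩ := exists_iterated f M
  obtain ⟨Φ', -, e'⟩ := exists_iterated f M'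
  -- Injectivity survives `S ⊗_R -` by right flatness and then `- ⊗_R S` by left flatness.
  have h1 := hl _ _ (LeftChange.mapLinear f h) (LeftChange.map_injective hr (toAddMonoidHom_inl_smul h) hinj)
  have key : Φ'.comp (BaseChange.map (envMap f) h) =
      (BalTensor.map R (LeftChange.mapLinear f h) (LinearMap.id : S →ₗ[R] S)).comp Φ :=
    BaseChange.env_hom_ext fun x y m => by
      rw [AddMonoidHom.comp_apply, AddMonoidHom.comp_apply, e, BaseChange.map_tmul, e']; rfl
  refine Function.Injective.of_comp (f := Φ') ?_
  rw [← AddMonoidHom.coe_comp, key]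
  exact h1.comp hΦ

/-! ### The filter of the symmetric tensoring torsion theory -/

variable (f M) in
theorem subsingleton_twoSidedTensor_iff :
    Subsingleton (TwoSidedTensor f M) ↔ Subsingleton (BaseChange (envMap f) M) := by
  let π := QuotientAddGroup.mk' (twoSidedRel f M)
  let t : S →+ S →+ M →+ TwoSidedTensor f M :=
    AddMonoidHom.mk' (fun x => AddMonoidHom.mk' (fun y => AddMonoidHom.mk'
      (fun m => π ((x ⊗ₜ m) ⊗ₜ y))
      fun m m' => by rw [TensorProduct.tmul_add, TensorProduct.add_tmul, map_add])
      fun y y' => by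
        ext m
        change π ((x ⊗ₜ m) ⊗ₜ (y + y')) = π ((x ⊗ₜ m) ⊗ₜ y) + π ((x ⊗ₜ m) ⊗ₜ y')
        rw [TensorProduct.tmul_add, map_add])
      fun x x' => by
        ext y m
        change π (((x + x') ⊗ₜ m) ⊗ₜ y) = π ((x ⊗ₜ m) ⊗ₜ y) + π ((x' ⊗ₜ m) ⊗ₜ y)
        rw [TensorProduct.add_tmul, TensorProduct.add_tmul, map_add]
  obtain ⟨Φ, hΦ⟩ := BaseChange.exists_env_lift (f := f) (M := M) t
    (fun x y a m => (QuotientAddGroup.eq_iff_sub_mem (N := twoSidedRel f M)).2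
      (AddSubgroup.subset_closure (Or.inl ⟨x, a, m, y, rfl⟩)))
    (fun x y b m => ((QuotientAddGroup.eq_iff_sub_mem (N := twoSidedRel f M)).2
      (AddSubgroup.subset_closure (Or.inr ⟨x, m, b, y, rfl⟩))).symm)
  let τ : S →+ M →+ S →+ BaseChange (envMap f) M :=
    AddMonoidHom.mk' (fun x => AddMonoidHom.mk' (fun m => AddMonoidHom.mk'
      (fun y => BaseChange.tmul (envMap f) (x ⊗ₜ MulOpposite.op y) m)
      fun y y' => by
        rw [MulOpposite.op_add, TensorProduct.tmul_add, map_add, AddMonoidHom.add_apply])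
      fun m m' => by ext y; exact map_add (BaseChange.tmul (envMap f) (x ⊗ₜ MulOpposite.op y)) m m')
      fun x x' => by
        ext m y
        change BaseChange.tmul (envMap f) ((x + x') ⊗ₜ MulOpposite.op y) m =
          BaseChange.tmul (envMap f) (x ⊗ₜ MulOpposite.op y) m +
          BaseChange.tmul (envMap f) (x' ⊗ₜ MulOpposite.op y) m
        rw [TensorProduct.add_tmul, map_add, AddMonoidHom.add_apply]
  let τ' : (S ⊗[ℤ] M) ⊗[ℤ] S →+ BaseChange (envMap f) M :=
    TensorProduct.liftAddHom (TensorProduct.liftAddHom τ fun z x m => by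
      rw [map_zsmul, map_zsmul, AddMonoidHom.zsmul_apply]) fun z x m => by
      rw [map_zsmul, map_zsmul, AddMonoidHom.zsmul_apply]
  have hτ' (x y : S) (m : M) : τ' ((x ⊗ₜ m) ⊗ₜ y) =
    BaseChange.tmul (envMap f) (x ⊗ₜ MulOpposite.op y) m := rfl
  let Ψ : TwoSidedTensor f M →+ BaseChange (envMap f) M := QuotientAddGroup.lift _ τ' <| by
    rw [twoSidedRel, AddSubgroup.closure_le]
    rintro _ (⟨x, a, m, y, rfl⟩ | ⟨x, m, b, y, rfl⟩)
    · change τ' _ = 0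
      rw [map_sub, hτ', hτ', ← BaseChange.mul_tmul, tmul_mul_envMap_inl, sub_self]
    · change τ' _ = 0
      rw [map_sub, hτ', hτ', ← BaseChange.mul_tmul, tmul_mul_envMap_inr, MulOpposite.unop_op,
        sub_self]
  have h1 : Ψ.comp Φ = AddMonoidHom.id _ := BaseChange.env_hom_ext fun x y m => by
    rw [AddMonoidHom.comp_apply, hΦ]; rfl
  have h2 (x : TwoSidedTensor f M) : Φ (Ψ x) = x := by
    obtain ⟨x, rfl⟩ := QuotientAddGroup.mk'_surjective _ x
    induction x with
    | zero => rw [map_zero, map_zero, map_zero]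
    | tmul z y =>
      induction z with
      | zero => rw [TensorProduct.zero_tmul, map_zero, map_zero, map_zero]
      | tmul x m => exact hΦ x y m
      | add z w h h' => rw [TensorProduct.add_tmul, map_add, map_add, map_add, h, h']
    | add z w h h' => rw [map_add, map_add, map_add, h, h']
  exact ⟨fun _ => Function.Surjective.subsingleton (f := Ψ) fun x => ⟨Φ x, DFunLike.congr_fun h1 x⟩,
    fun _ => Function.Surjective.subsingleton (f := Φ) fun x => ⟨Ψ x, h2 x⟩⟩

/-- Places the two-sided torsion theory under the one-sided theory for `envMap f`; the Gabriel
property and the lifting of homomorphisms then follow from flatness of `envMap f`. -/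
theorem symmetricTensorFilter_eq : symmetricTensorFilter f = leftTensorFilter (envMap f) :=
  Set.ext fun K => subsingleton_twoSidedTensor_iff f (Env R ⧸ K)

/-- For a two-sided flat extension the elements with denominators on both sides form the symmetric
ring of quotients with respect to the symmetric tensoring torsion theory. -/
theorem isSymmetricRingOfQuotients_symmetricTensorFilter (hinj : Function.Injective f)
    (hl : IsLeftFlat f) (hr : IsRightFlat f) {T : Subring S} (hT : T = symDenomSubring f)
    {q : R →+* T} (hq : T.subtype.comp q = f) :
    IsSymmetricRingOfQuotients (symmetricTensorFilter f) (leftTensorFilter f)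
      (rightTensorFilter f) q := by
  have hp := isRightFlat_envMap hl hr
  have hl' := isLeftFlat_iff_op.1 hl
  rw [symmetricTensorFilter_eq, rightTensorFilter_eq, hr.leftTensorFilter_eq,
    hl'.leftTensorFilter_eq]
  subst hT
  refine isSymmetricRingOfQuotients_subring hq hinj (isGabriel_denomFilter _)
    (isGabriel_denomFilter _) (hp.leftTensorFilter_eq ▸ isGabriel_denomFilter _) ?_ ?_ ?_
    (fun I hI x => eq_zero_of_map_eq_top (M := S) (map_eq_top_of_mem_denomFilter hI))
  · exact fun K hK x hx => eq_zero_of_map_eq_top (M := S) (mem_leftTensorFilter.1 hK) fun κ hκ =>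
      (envMap_smul κ x).trans (hx κ hκ)
  · intro K hK φ
    rw [mem_leftTensorFilter] at hK
    obtain ⟨s, hs⟩ := hp.exists_smul_eq hK (f.toAddMonoidHom.comp φ.toAddMonoidHom) fun ε κ => by
      change f (φ (ε • κ)) = envMap f ε • f (φ κ)
      rw [map_smul, map_env_smul, envMap_smul]
    have hs' (κ : K) : bimoduleAction f κ s = f (φ κ) := (envMap_smul _ _).symm.trans (hs κ)
    -- All of `K` carries `s` into `f(R)`, so `s` lies in the dominion; one-sided denominators then
    -- come from flatness on each side.
    have hd : InDominion f s := inDominion_of_map_envDenomIdeal f <|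
      map_eq_top_mono (fun κ hκ => ⟨φ ⟨κ, hκ⟩, (hs' ⟨κ, hκ⟩).symm⟩) hK
    exact ⟨s, ⟨hr.mem_denomSubring hd, hl'.mem_denomSubring hd.op⟩, hs'⟩
  · refine fun s hs => ⟨envDenomIdeal f s, ?_, fun κ hκ => hκ⟩
    rw [mem_leftTensorFilter]
    -- The left denominators of `s` alone generate the unit ideal of `Env S`.
    refine map_envMap_eq_top_of_comap ?_
    rw [comap_inlHom_envDenomIdeal]
    exact map_eq_top_of_mem_denomFilter hs.1

end TwoSided

/-! ### Perfect symmetric rings of quotients -/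

section Perfect

variable {A B C : Type u} [Ring A] [Ring B] [Ring C] {f : A →+* B}

theorem IsPerfectSymmetric.symDenomSubring_eq_top (h : IsPerfectSymmetric f) :
    symDenomSubring f = ⊤ :=
  top_le_iff.1 fun s _ => ⟨h.2.2.mem_denomSubring (h.1.inDominion s),
    (isLeftFlat_iff_op.1 h.2.1).mem_denomSubring (h.1.inDominion s).op⟩

theorem isPerfectSymmetric_of_symDenomSubring_eq_top (hf : Function.Injective f)
    (h : symDenomSubring f = ⊤) : IsPerfectSymmetric f := by
  have h' (s : B) : s ∈ symDenomSubring f := h ▸ Subring.mem_top s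
  refine ⟨isRingEpi_of_map_denomIdeal fun s => map_eq_top_of_mem_denomFilter (h' s).1,
    isLeftFlat_iff_op.2 (isRightFlat_of_denomIdeal (fun a b e => ?_) fun s => (h' s.unop).2),
    isRightFlat_of_denomIdeal hf fun s => (h' s).1⟩
  exact MulOpposite.unop_injective (hf (MulOpposite.op_injective e))

/-- A relation `1 = ∑ b_k f(a_k)` in denominators `a_k` is preserved by `j`. This carries the
denominators of an intermediate ring over to `S`. -/
theorem denomSubring_le_comap (f : A →+* B) (j : B →+* C) :
    denomSubring f ≤ (denomSubring (j.comp f)).comap j := by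
  intro s hs a
  have h1 : (colon (denomIdeal f s) a).map f ≤
      ((colon (denomIdeal (j.comp f) (j s)) a).map (j.comp f)).comap j :=
    Ideal.span_le.2 <| by
      rintro _ ⟨b, hb, rfl⟩
      refine Ideal.mem_map_of_mem (j.comp f) (I := colon _ a) (x := b) ?_
      obtain ⟨c, hc⟩ := hb
      exact ⟨c, (congrArg j hc).trans (map_mul j _ _)⟩
  rw [hs a] at h1
  rw [Ideal.eq_top_iff_one, ← map_one j]
  exact h1 Submodule.mem_top

theorem symDenomSubring_le_comap (f : A →+* B) (j : B →+* C) :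
    symDenomSubring f ≤ (symDenomSubring (j.comp f)).comap j := fun _ hs =>
  ⟨denomSubring_le_comap f j hs.1, denomSubring_le_comap (RingHom.op f) (RingHom.op j) hs.2⟩

end Perfect

end SymQuot

/-! ### The main theorem -/

open SymQuot in
theorem mainTheorem7 {S : Type u} [Ring S] (R : Subring S) :
    -- `S'` is a subring containing `R`, and a symmetric ring of quotients of `R`
    (∃ (S' : Subring S) (hS' : R ≤ S'), (S' : Set S) = derived R Set.univ ∧
      IsSymmetricRingOfQuotients (inducedFilter (leftFilter R) (rightFilter R))
        (leftFilter R) (rightFilter R) (Subring.inclusion hS') ∧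
      (IsLeftFlat R.subtype → IsRightFlat R.subtype →
        IsSymmetricRingOfQuotients (symmetricTensorFilter R.subtype)
          (leftTensorFilter R.subtype) (rightTensorFilter R.subtype) (Subring.inclusion hS') ∧
        IsSymmetricRingOfQuotients
          (inducedFilter (leftTensorFilter R.subtype) (rightTensorFilter R.subtype))
          (leftTensorFilter R.subtype) (rightTensorFilter R.subtype)
          (Subring.inclusion hS'))) ∧
    -- `S` is perfect symmetric iff `S' = S`
    (IsPerfectSymmetric R.subtype ↔ derived R Set.univ = Set.univ) ∧
    -- the transfinite sequence consists of intermediate rings and stabilizes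
    ((∀ α : Ordinal.{u}, ∃ T : Subring S, R ≤ T ∧ (T : Set S) = derivedSeq R α) ∧
      ∃ γ : Ordinal.{u}, derivedSeq R γ = derivedSeq R (γ + 1) ∧
        ∀ α, γ ≤ α → derivedSeq R α = derivedSeq R γ) ∧
    -- perfect symmetric intermediate rings lie in `S'`
    (∀ (T : Subring S) (hT : R ≤ T), IsPerfectSymmetric (Subring.inclusion hT) →
      (T : Set S) ⊆ derived R Set.univ) := by
  have hR : R ≤ symDenomSubring R.subtype := fun r hr =>
    range_le_symDenomSubring R.subtype ⟨⟨r, hr⟩, rfl⟩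
  have hinj : Function.Injective R.subtype := Subtype.val_injective
  have hind := isSymmetricRingOfQuotients_induced hinj
    (T := symDenomSubring R.subtype) rfl (q := Subring.inclusion hR) rfl
  refine ⟨⟨symDenomSubring R.subtype, hR, (derived_univ R).symm, ?_, fun hl hr => ⟨?_, ?_⟩⟩,
    ⟨fun h => ?_, fun h => ?_⟩, ⟨exists_subring_eq_derivedSeq R, exists_derivedSeq_stable R⟩,
    fun T hT h t ht => ?_⟩
  · rw [leftFilter_eq, rightFilter_eq]
    exact hind
  · exact isSymmetricRingOfQuotients_symmetricTensorFilter hinj hl hr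
      (T := symDenomSubring R.subtype) rfl (q := Subring.inclusion hR) rfl
  · rw [rightTensorFilter_eq, hr.leftTensorFilter_eq,
      (isLeftFlat_iff_op.1 hl).leftTensorFilter_eq]
    exact hind
  · rw [derived_univ, h.symDenomSubring_eq_top]; rfl
  · exact isPerfectSymmetric_of_symDenomSubring_eq_top hinj
      (SetLike.coe_injective ((derived_univ R).symm.trans h))
  · rw [derived_univ]
    have : (⟨t, ht⟩ : T) ∈ symDenomSubring (Subring.inclusion hT) :=
      h.symDenomSubring_eq_top ▸ Subring.mem_top _
    have e : T.subtype.comp (Subring.inclusion hT) = R.subtype := rfl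
    have h' := symDenomSubring_le_comap (Subring.inclusion hT) T.subtype this
    rw [Subring.mem_comap, e] at h'
    exact h'
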